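/- Let $d\ge 0$, $n\ge 1$, $f(w)=\frac1n\sum_{i=1}^n f(w,i)$ with $f(\cdot,i):\mathbb R^d\to\mathbb R$, let $\varphi:\mathbb R^d\to(-\infty,\infty]$ be proper and lower semicontinuous, and $\psi=f+\varphi$. Assume that $\varphi$ is $\rho$-weakly convex with $\rho\ge 0$, i.e., $\varphi+\frac\rho2\|\cdot\|^2$ is convex, and that for some $\mathsf L>0$ each $f(\cdot,i)$ is differentiable at every point of $\mathrm{dom}\,\varphi=\{\varphi<\infty\}$ with $\|\nabla f(w,i)-\nabla f(v,i)\|\le \mathsf L\|w-v\|$ for all $w,v\in\mathrm{dom}\,\varphi$. Let $\psi^*=\inf_w\psi(w)$ and $\mathcal W=\{w:\psi(w)=\psi^*\}$. Assume $\mathcal W\neq\emptyset$ and that, for some $\mu>0$, the Polyak–Łojasiewicz (PL) inequality $\mathrm{dist}(0,\partial\psi(w))^2\ge 2\mu(\psi(w)-\psi^*)$ holds for all $w\in\mathbb R^d$. Here $\partial\psi(w)$ is the Fréchet subdifferential ($g\in\partial\psi(w)$ iff $\psi(w)<\infty$ and $\psi(y)\ge\psi(w)+\langle g,y-w\rangle+o(\|y-w\|)$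 as $y\to w$), and the distance to the empty set is $\infty$. Put $\sigma_*^2=\sup_{w\in\mathcal W}\frac1n\sum_{j=1}^n\|\nabla f(w,j)-\nabla f(w)\|^2\in[0,\infty]$. Let $\lambda>0$ with $4\lambda\rho<1$ and write $\mathrm{prox}(z)$ for the unique minimizer of $y\mapsto\varphi(y)+\frac1{2\lambda}\|z-y\|^2$. Given $z^1\in\mathbb R^d$, step sizes $\alpha_k>0$ and permutations $\pi^k$ of $\{1,\dots,n\}$, the method norm-PRR sets, for $k=1,2,\dots$, $z^k_1=z^k$, $$z^k_{i+1}=z^k_i-\alpha_k\big(\nabla f(w^k_i,\pi^k_i)+\lambda^{-1}(z^k_i-w^k_i)\big),\quad w^k_i=\mathrm{prox}(z^k_i),\quad i=1,\dots,n,$$ $z^{k+1}=z^k_{n+1}$ and $w^{k+1}=\mathrm{prox}(z^{k+1})$. Define $$\mathsf C=4\Big[\frac{3\mathsf L+2\lambda^{-1}-\rho}{1-\lambda\rho}\Big]^2,\quad \tau=\frac{1-4\lambda\rho}{2(1-2\lambda\rho+\lambda^2\mathsf L^2)},\quad \bar\alpha=\max\{\sqrt{2\mathsf C},10\mathsf L,4\mathsf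 C\lambda\tau^{-1}\}^{-1},\quad \nu=\frac{\mu\tau}{3(1+\mu\tau\lambda)},$$ and $H_\tau(z)=\psi(\mathrm{prox}(z))+\frac{\tau\lambda}2\big\|\nabla f(\mathrm{prox}(z))+\lambda^{-1}(z-\mathrm{prox}(z))\big\|^2$. Let $\alpha_k=\alpha/n$ for all $k$, where $0<\alpha\le\min\{\bar\alpha,\ \nu^{-1},\ \mu\sqrt\tau/(2\mathsf L\sqrt{6\mathsf C})\}$. (a) For every sequence of permutations and all $T\ge1$, $$\psi(w^{T+1})-\psi^*\le \exp(-T\nu\alpha)\,\frac{H_\tau(z^1)-\psi^*}{1+\mu\tau\lambda}+\frac{6\mathsf C\alpha^2\sigma_*^2}{\mu\tau}.$$ (b) If the permutations $\pi^k$ are random, independent and each uniformly distributed on all permutations of $\{1,\dots,n\}$ ($z^1$ being deterministic), then for all $T\ge1$ $$\mathbb E[\psi(w^{T+1})-\psi^*]\le \exp(-T\nu\alpha)\,\frac{H_\tau(z^1)-\psi^*}{1+\mu\tau\lambda}+\frac{6\mathsf C\alpha^2\sigma_*^2}{n\mu\tau}.$$ In particular, in the interpolation case $\sigma_*^2=0$,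 for every sequence of permutations and all $T\ge 1$, $\psi(w^{T+1})-\psi^*\le\exp(-T\nu\alpha)\,\frac{H_\tau(z^1)-\psi^*}{1+\mu\tau\lambda}$, i.e., linear convergence. -/

import Mathlib

open MeasureTheory ProbabilityTheory Filter Topology

noncomputable section

namespace NormPRR

variable {d n : ℕ}

/-! ### Nonsmooth analysis for functions with values in `(-∞, ∞]` -/

/-- The effective domain `dom h = {w : h w < ∞}`. -/
def dom (h : EuclideanSpace ℝ (Fin d) → EReal) : Set (EuclideanSpace ℝ (Fin d)) :=
  {w | h w ≠ ⊤}

/-- `h` takes values in `(-∞, ∞]` and is finite somewhere. -/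
def Proper (h : EuclideanSpace ℝ (Fin d) → EReal) : Prop :=
  (∀ w, h w ≠ ⊥) ∧ (dom h).Nonempty

/-- `ρ`-weak convexity of a function with values in `(-∞, ∞]`: `h + (ρ/2)‖·‖²` is convex,
that is, its effective domain is convex and it is convex as a real function there. -/
def WeaklyConvex (ρ : ℝ) (h : EuclideanSpace ℝ (Fin d) → EReal) : Prop :=
  ConvexOn ℝ (dom h) (fun w => (h w).toReal + ρ / 2 * ‖w‖ ^ 2)

/-- The Fréchet (regular) subdifferential, empty outside the effective domain:
`g ∈ ∂h(x)` iff `h y ≥ h x + ⟪g, y - x⟫ + o(‖y - x‖)` as `y → x`. -/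
def subdiff (h : EuclideanSpace ℝ (Fin d) → EReal) (x : EuclideanSpace ℝ (Fin d)) :
    Set (EuclideanSpace ℝ (Fin d)) :=
  {g | x ∈ dom h ∧ ∀ ε : ℝ, 0 < ε → ∀ᶠ y in 𝓝 x,
    h x + ((inner ℝ g (y - x) - ε * ‖y - x‖ : ℝ) : EReal) ≤ h y}

/-- The objective `y ↦ φ y + ‖z - y‖² / (2λ)` of the proximal subproblem. -/
def proxObj (lam : ℝ) (φ : EuclideanSpace ℝ (Fin d) → EReal) (z y : EuclideanSpace ℝ (Fin d)) :
    EReal :=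
  φ y + ((1 / (2 * lam) * ‖z - y‖ ^ 2 : ℝ) : EReal)

/-- The proximity operator `prox_{λφ}(z) = argmin_y φ y + ‖z - y‖² / (2λ)`. The minimizer exists
and is unique if `φ` is proper, lsc and `ρ`-weakly convex and `λρ < 1`. -/
def prox (lam : ℝ) (φ : EuclideanSpace ℝ (Fin d) → EReal) (z : EuclideanSpace ℝ (Fin d)) :
    EuclideanSpace ℝ (Fin d) :=
  Classical.epsilon fun y => IsMinOn (proxObj lam φ z) Set.univ y

/-! ### The composite finite-sum problem -/

/-- `f(w) = (1/n) ∑ᵢ f(w, i)`. -/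
def avg (f : Fin n → EuclideanSpace ℝ (Fin d) → ℝ) (w : EuclideanSpace ℝ (Fin d)) : ℝ :=
  1 / (n : ℝ) * ∑ i, f i w

/-- `ψ = f + φ`. -/
def objective (f : Fin n → EuclideanSpace ℝ (Fin d) → ℝ)
    (φ : EuclideanSpace ℝ (Fin d) → EReal) (w : EuclideanSpace ℝ (Fin d)) : EReal :=
  (avg f w : EReal) + φ w

/-- `ψ* = inf_w ψ(w)`. -/
def optVal (ψ : EuclideanSpace ℝ (Fin d) → EReal) : EReal := ⨅ w, ψ w

/-- The set `𝒲` of optimal solutions. -/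
def optSet (ψ : EuclideanSpace ℝ (Fin d) → EReal) : Set (EuclideanSpace ℝ (Fin d)) :=
  {w | ψ w = optVal ψ}

/-- The PL condition with constant `μ`: `dist(0, ∂ψ(w))² ≥ 2μ(ψ(w) - ψ*)` for all `w`, where
the distance to the empty set is `∞`. -/
def PLCondition (μ : ℝ) (ψ : EuclideanSpace ℝ (Fin d) → EReal) : Prop :=
  0 < μ ∧ ∀ w, ((2 * μ : ℝ) : EReal) * (ψ w - optVal ψ) ≤
    ((Metric.infEDist 0 (subdiff ψ w) ^ 2 : ENNReal) : EReal)

/-- `(1/n) ∑ⱼ ‖∇f(w, j) - ∇f(w)‖²`. -/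
def gradVariance (f : Fin n → EuclideanSpace ℝ (Fin d) → ℝ) (w : EuclideanSpace ℝ (Fin d)) : ℝ :=
  1 / (n : ℝ) * ∑ j, ‖gradient (f j) w - gradient (avg f) w‖ ^ 2

/-- `σ_*²`, the supremum of the gradient variance over the optimal solutions (possibly `∞`). -/
def sigmaStarSq (f : Fin n → EuclideanSpace ℝ (Fin d) → ℝ)
    (φ : EuclideanSpace ℝ (Fin d) → EReal) : EReal :=
  ⨆ w ∈ optSet (objective f φ), (gradVariance f w : EReal)

/-- The normal map `F(z) = ∇f(prox z) + λ⁻¹ (z - prox z)`. -/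
def normalMap (lam : ℝ) (f : Fin n → EuclideanSpace ℝ (Fin d) → ℝ)
    (φ : EuclideanSpace ℝ (Fin d) → EReal) (z : EuclideanSpace ℝ (Fin d)) :
    EuclideanSpace ℝ (Fin d) :=
  gradient (avg f) (prox lam φ z) + lam⁻¹ • (z - prox lam φ z)

/-- The merit function `H_τ(z) = ψ(prox z) + (τλ/2) ‖F(z)‖²`. -/
def merit (τ lam : ℝ) (f : Fin n → EuclideanSpace ℝ (Fin d) → ℝ)
    (φ : EuclideanSpace ℝ (Fin d) → EReal) (z : EuclideanSpace ℝ (Fin d)) : EReal :=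
  objective f φ (prox lam φ z) + ((τ * lam / 2 * ‖normalMap lam f φ z‖ ^ 2 : ℝ) : EReal)

/-! ### The algorithm norm-PRR -/

/-- One inner step with component `i` and step size `a`:
`z ↦ z - a (∇f(w, i) + λ⁻¹ (z - w))` where `w = prox z`. -/
def innerStep (lam : ℝ) (f : Fin n → EuclideanSpace ℝ (Fin d) → ℝ)
    (φ : EuclideanSpace ℝ (Fin d) → EReal) (a : ℝ) (i : Fin n) (z : EuclideanSpace ℝ (Fin d)) :
    EuclideanSpace ℝ (Fin d) :=
  z - a • (gradient (f i) (prox lam φ z) + lam⁻¹ • (z - prox lam φ z))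

/-- The point reached after the first `i` inner steps (`i ≤ n`) of an epoch that starts
at `z` and uses the permutation `σ`. -/
def innerIter (lam : ℝ) (f : Fin n → EuclideanSpace ℝ (Fin d) → ℝ)
    (φ : EuclideanSpace ℝ (Fin d) → EReal) (a : ℝ) (σ : Equiv.Perm (Fin n))
    (z : EuclideanSpace ℝ (Fin d)) : ℕ → EuclideanSpace ℝ (Fin d)
  | 0 => z
  | i + 1 =>
    if h : i < n then innerStep lam f φ a (σ ⟨i, h⟩) (innerIter lam f φ a σ z i)
    else innerIter lam f φ a σ z i

/-- The outer iterates, counted from `0`: `zIter … k` is the point `z^{k+1}` obtained from the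
initial point `z^1 = z₁` after `k` epochs. Epoch number `k + 1` uses the step size `α k` and the
permutation `π k`. -/
def zIter (lam : ℝ) (f : Fin n → EuclideanSpace ℝ (Fin d) → ℝ)
    (φ : EuclideanSpace ℝ (Fin d) → EReal) (α : ℕ → ℝ) (π : ℕ → Equiv.Perm (Fin n))
    (z₁ : EuclideanSpace ℝ (Fin d)) : ℕ → EuclideanSpace ℝ (Fin d)
  | 0 => z₁
  | k + 1 => innerIter lam f φ (α k) (π k) (zIter lam f φ α π z₁ k) n

/-- The iterates `w^{k+1} = prox(z^{k+1})`, counted from `0`. -/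
def wIter (lam : ℝ) (f : Fin n → EuclideanSpace ℝ (Fin d) → ℝ)
    (φ : EuclideanSpace ℝ (Fin d) → EReal) (α : ℕ → ℝ) (π : ℕ → Equiv.Perm (Fin n))
    (z₁ : EuclideanSpace ℝ (Fin d)) (k : ℕ) : EuclideanSpace ℝ (Fin d) :=
  prox lam φ (zIter lam f φ α π z₁ k)

/-- The random permutations are independent and each is uniformly distributed on the set of all
`n!` permutations. -/
def UniformReshuffling {Ω : Type*} [MeasurableSpace Ω] (P : Measure Ω)
    (π : ℕ → Ω → Equiv.Perm (Fin n)) : Prop :=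
  (∀ k, @Measurable Ω (Equiv.Perm (Fin n)) _ ⊤ (π k)) ∧
  iIndepFun (m := fun _ => (⊤ : MeasurableSpace (Equiv.Perm (Fin n)))) π P ∧
  ∀ k σ, P {ω | π k ω = σ} = ((n.factorial : ℕ) : ENNReal)⁻¹

/-! ### The constants -/

/-- `C = 4 [(3L + 2λ⁻¹ - ρ) / (1 - λρ)]²`. -/
def constC (L ρ lam : ℝ) : ℝ := 4 * ((3 * L + 2 * lam⁻¹ - ρ) / (1 - lam * ρ)) ^ 2

/-- `τ = (1 - 4λρ) / (2 (1 - 2λρ + λ² L²))`. -/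
def constTau (L ρ lam : ℝ) : ℝ :=
  (1 - 4 * lam * ρ) / (2 * (1 - 2 * lam * ρ + lam ^ 2 * L ^ 2))

/-- `ᾱ = 1 / max {√(2C), 10 L, 4 C λ / τ}`. -/
def alphaBar (L ρ lam : ℝ) : ℝ :=
  (max (Real.sqrt (2 * constC L ρ lam))
    (max (10 * L) (4 * constC L ρ lam * lam / constTau L ρ lam)))⁻¹

/-- `ν = μτ / (3 (1 + μτλ))`. -/
def constNu (L ρ lam μ : ℝ) : ℝ :=
  μ * constTau L ρ lam / (3 * (1 + μ * constTau L ρ lam * lam))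

/-- The linear term `exp(-Tνα) (H_τ(z₁) - ψ*) / (1 + μτλ)` of the bound. -/
def linearTerm (L ρ lam μ α : ℝ) (f : Fin n → EuclideanSpace ℝ (Fin d) → ℝ)
    (φ : EuclideanSpace ℝ (Fin d) → EReal) (z₁ : EuclideanSpace ℝ (Fin d)) (T : ℕ) : EReal :=
  ((Real.exp (-(T * constNu L ρ lam μ * α)) / (1 + μ * constTau L ρ lam * lam) : ℝ) : EReal) *
    (merit (constTau L ρ lam) lam f φ z₁ - optVal (objective f φ))

end NormPRR

end

namespace NormPRR

variable {d n : ℕ}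

/-! ### Proximity operators of weakly convex functions -/

/-! The merit function `H_τ` is a Lyapunov function for whole epochs. If `w = prox z`, then `λ⁻¹ (z
- w)` is a subgradient of `φ` at `w` up to a quadratic error, so the normal map `F(z)` lies in
`∂ψ(w)` (`normalMap_mem_subdiff`). The PL inequality then reads `‖F(z)‖² ≥ 2μ(ψ(w) - ψ*)`, which
bounds `H_τ(z) - ψ*` by a multiple of `‖F(z)‖²`.

An epoch is regarded as the exact step `z ↦ z - α F(z)` plus an error `e`. For any target point
whatsoever, the merit function drops by a multiple of `τα‖F(z)‖²` up to `‖e‖²/α` (`meritReal_le`).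
The deviations of the component gradients from the mean sum to zero, so an epoch with increments
frozen at `z` would be exact. The true error comes from the drift of the inner iterates and is
governed by the squared partial sums of these deviations (`norm_sq_epoch_error_le`). Cauchy–Schwarz
bounds them for every order (`partialSumsSq_perm_le`); in a uniformly random order distinct terms
are nonpositively correlated, which gains a factor `1/n` (`sum_perm_partialSumsSq_le`).

This produces the gradient variance at the iterate, whereas `σ_*²` only controls it at solutions.
The bridge is quadratic growth, a consequence of PL (`exists_optimal_near`): every point of `dom φ`
is close to a solution, and the variance changes in a Lipschitz manner (`gradVariance_le`). The
excess, proportional to `ψ(w) - ψ*`, is paid for by a reserved part of the descent. What remains is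
a linear recursion with factor `1 - να`. -/

/-- A proper, lower semicontinuous, `ρ`-weakly convex function with values in `(-∞, ∞]`. -/
structure ClosedWeaklyConvex (ρ : ℝ) (φ : EuclideanSpace ℝ (Fin d) → EReal) : Prop where
  proper : Proper φ
  lsc : LowerSemicontinuous φ
  weak : WeaklyConvex ρ φ

variable {φ : EuclideanSpace ℝ (Fin d) → EReal} {ρ lam : ℝ}

lemma ClosedWeaklyConvex.coe_toReal (h : ClosedWeaklyConvex ρ φ) {w} (hw : w ∈ dom φ) :
    ((φ w).toReal : EReal) = φ w :=
  EReal.coe_toReal hw (h.proper.1 w)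

lemma norm_sq_lineMap (x y : EuclideanSpace ℝ (Fin d)) (t : ℝ) :
    ‖(1 - t) • x + t • y‖ ^ 2 = (1 - t) * ‖x‖ ^ 2 + t * ‖y‖ ^ 2 - t * (1 - t) * ‖y - x‖ ^ 2 := by
  rw [norm_add_sq_real, norm_sub_sq_real, norm_smul, norm_smul, mul_pow, mul_pow,
    real_inner_smul_left, real_inner_smul_right, real_inner_comm x y, Real.norm_eq_abs,
    Real.norm_eq_abs, sq_abs, sq_abs]
  ring

lemma ClosedWeaklyConvex.lineMap_mem (h : ClosedWeaklyConvex ρ φ) {x y} (hx : x ∈ dom φ)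
    (hy : y ∈ dom φ) {t : ℝ} (h0 : 0 ≤ t) (h1 : t ≤ 1) : (1 - t) • x + t • y ∈ dom φ :=
  h.weak.1 hx hy (by linarith) h0 (by ring)

lemma ClosedWeaklyConvex.lineMap_le (h : ClosedWeaklyConvex ρ φ) {x y} (hx : x ∈ dom φ)
    (hy : y ∈ dom φ) {t : ℝ} (h0 : 0 ≤ t) (h1 : t ≤ 1) :
    (φ ((1 - t) • x + t • y)).toReal ≤ (1 - t) * (φ x).toReal + t * (φ y).toReal
      + ρ / 2 * (t * (1 - t) * ‖y - x‖ ^ 2) := by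
  have := h.weak.2 hx hy (by linarith : 0 ≤ 1 - t) h0 (by ring)
  simp only [smul_eq_mul, norm_sq_lineMap] at this
  linarith

/-- Lower semicontinuity bounds `φ` below on the unit ball around `x₀`. Weak convexity on the
segment from `x₀` to a distant `y`, which crosses the unit sphere at parameter `R⁻¹`, carries this
bound out to `y`. -/
lemma ClosedWeaklyConvex.exists_quadratic_minorant (h : ClosedWeaklyConvex ρ φ) :
    ∃ x₀ ∈ dom φ, ∃ M : ℝ, ∀ y ∈ dom φ, 1 ≤ ‖y - x₀‖ →
      -(M * ‖y - x₀‖) - ρ / 2 * ‖y - x₀‖ ^ 2 + ρ / 2 * ‖y - x₀‖ ≤ (φ y).toReal := by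
  obtain ⟨x₀, hx₀⟩ := h.proper.2
  obtain ⟨a, ha, hmin⟩ := (h.lsc.lowerSemicontinuousOn (Metric.closedBall x₀ 1)).exists_isMinOn
    ⟨x₀, by simp⟩ (isCompact_closedBall x₀ 1)
  have had : a ∈ dom φ := by
    have := hmin (Metric.mem_closedBall_self zero_le_one : x₀ ∈ Metric.closedBall x₀ 1)
    exact ne_top_of_le_ne_top hx₀ this
  refine ⟨x₀, hx₀, |(φ a).toReal| + |(φ x₀).toReal|, fun y hy hR => ?_⟩
  set R := ‖y - x₀‖ with hRdef
  have hRpos : 0 < R := by linarith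
  have ht0 : 0 ≤ R⁻¹ := by positivity
  have ht1 : R⁻¹ ≤ 1 := inv_le_one_of_one_le₀ hR
  have hball : (1 - R⁻¹) • x₀ + R⁻¹ • y ∈ Metric.closedBall x₀ 1 := by
    rw [Metric.mem_closedBall, dist_eq_norm]
    have : (1 - R⁻¹) • x₀ + R⁻¹ • y - x₀ = R⁻¹ • (y - x₀) := by module
    rw [this, norm_smul, Real.norm_of_nonneg ht0, ← hRdef, inv_mul_cancel₀ hRpos.ne']
  have hle := hmin hball
  have hmem := h.lineMap_mem hx₀ hy ht0 ht1
  have h1 : (φ a).toReal ≤ (φ ((1 - R⁻¹) • x₀ + R⁻¹ • y)).toReal := by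
    rw [← EReal.coe_le_coe_iff, h.coe_toReal had, h.coe_toReal hmem]
    exact hle
  have h2 := h1.trans (h.lineMap_le hx₀ hy ht0 ht1)
  rw [← hRdef] at h2
  have h3 := mul_le_mul_of_nonneg_left h2 hRpos.le
  have e1 : R * ((1 - R⁻¹) * (φ x₀).toReal + R⁻¹ * (φ y).toReal
      + ρ / 2 * (R⁻¹ * (1 - R⁻¹) * R ^ 2)) =
      (R - 1) * (φ x₀).toReal + (φ y).toReal + ρ / 2 * (R ^ 2 - R) := by
    field_simp
  rw [e1] at h3
  have h4 : -(R * |(φ a).toReal|) ≤ R * (φ a).toReal := by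
    nlinarith [neg_abs_le (φ a).toReal]
  have h5 : (R - 1) * (φ x₀).toReal ≤ R * |(φ x₀).toReal| := by
    nlinarith [le_abs_self (φ x₀).toReal, abs_nonneg (φ x₀).toReal]
  nlinarith

lemma ClosedWeaklyConvex.lsc_proxObj (h : ClosedWeaklyConvex ρ φ) (lam : ℝ)
    (z : EuclideanSpace ℝ (Fin d)) : LowerSemicontinuous (proxObj lam φ z) := by
  refine LowerSemicontinuous.add' h.lsc ?_ ?_
  · apply Continuous.lowerSemicontinuous
    exact continuous_coe_real_ereal.comp (by fun_prop)
  · intro x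
    apply EReal.continuousAt_add
    · right; exact EReal.coe_ne_bot _
    · right; exact EReal.coe_ne_top _

lemma ClosedWeaklyConvex.exists_isMinOn_proxObj (h : ClosedWeaklyConvex ρ φ) (hlam : 0 < lam)
    (hlamρ : lam * ρ < 1) (z : EuclideanSpace ℝ (Fin d)) :
    ∃ y, IsMinOn (proxObj lam φ z) Set.univ y := by
  obtain ⟨x₀, hx₀, M, hM⟩ := h.exists_quadratic_minorant
  set K := proxObj lam φ z ⁻¹' Set.Iic (proxObj lam φ z x₀) with hK
  have hclosed : IsClosed K := (h.lsc_proxObj lam z).isClosed_preimage _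
  set b := ‖z - x₀‖
  set c := (φ x₀).toReal + 1 / (2 * lam) * b ^ 2
  -- Half of the curvature left once the proximal term has absorbed the concavity of `φ`; it makes
  -- the sublevel set `K` bounded.
  set k := (1 / lam - ρ) / 2 with hk
  have hkpos : 0 < k := by
    have : ρ < 1 / lam := by rw [lt_div_iff₀ hlam]; linarith
    rw [hk]; linarith
  set p := |M| + b / lam + |ρ| / 2
  have hbdd : K ⊆ Metric.closedBall x₀ (max 1 ((p + |c|) / k)) := by
    intro y hy
    rw [Metric.mem_closedBall, dist_eq_norm]
    by_contra! hlt
    obtain ⟨hR1, hR2⟩ := max_lt_iff.1 hlt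
    have hyK : φ y + ((1 / (2 * lam) * ‖z - y‖ ^ 2 : ℝ) : EReal)
        ≤ φ x₀ + ((1 / (2 * lam) * ‖z - x₀‖ ^ 2 : ℝ) : EReal) := hy
    have hyd : y ∈ dom φ := by
      intro htop
      rw [htop, EReal.top_add_coe, ← h.coe_toReal hx₀, ← EReal.coe_add] at hyK
      exact absurd (top_le_iff.1 hyK) (EReal.coe_ne_top _)
    rw [← h.coe_toReal hx₀, ← h.coe_toReal hyd, ← EReal.coe_add, ← EReal.coe_add,
      EReal.coe_le_coe_iff] at hyK
    have hm := hM y hyd hR1.le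
    set R := ‖y - x₀‖
    have htri : (R - b) ^ 2 ≤ ‖z - y‖ ^ 2 := by
      rw [sq_le_sq, abs_of_nonneg (norm_nonneg (z - y)), show z - y = (z - x₀) - (y - x₀) by abel,
        ← norm_sub_rev (y - x₀)]
      exact abs_norm_sub_norm_le _ _
    have h1 : 1 / (2 * lam) * (R - b) ^ 2 ≤ 1 / (2 * lam) * ‖z - y‖ ^ 2 := by gcongr
    have h2 : 1 / (2 * lam) * (R - b) ^ 2 = 1 / lam / 2 * R ^ 2 - R * (b / lam)
        + 1 / (2 * lam) * b ^ 2 := by field_simp; ring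
    have h3 : 0 ≤ 1 / (2 * lam) * b ^ 2 := by positivity
    have h4 : M * R ≤ |M| * R := by gcongr; exact le_abs_self M
    have h5 : - (ρ / 2 * R) ≤ |ρ| / 2 * R := by nlinarith [neg_abs_le ρ]
    have h6 : k * R ^ 2 - R * p ≤ c := by
      have : k * R ^ 2 = 1 / lam / 2 * R ^ 2 - ρ / 2 * R ^ 2 := by rw [hk]; ring
      rw [this]
      have : R * p = |M| * R + R * (b / lam) + |ρ| / 2 * R := by ring
      rw [this]
      linarith
    rw [div_lt_iff₀ hkpos] at hR2
    nlinarith [le_abs_self c, abs_nonneg c]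
  have hcompact : IsCompact K := (isCompact_closedBall _ _).of_isClosed_subset hclosed hbdd
  obtain ⟨y, hy, hmin⟩ := ((h.lsc_proxObj lam z).lowerSemicontinuousOn K).exists_isMinOn
    ⟨x₀, le_refl (proxObj lam φ z x₀)⟩ hcompact
  refine ⟨y, fun w _ => ?_⟩
  by_cases hw : w ∈ K
  · exact hmin hw
  · have : proxObj lam φ z x₀ < proxObj lam φ z w := not_le.1 hw
    exact (le_trans hy this.le : _)

lemma ClosedWeaklyConvex.prox_isMinOn (h : ClosedWeaklyConvex ρ φ) (hlam : 0 < lam)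
    (hlamρ : lam * ρ < 1) (z : EuclideanSpace ℝ (Fin d)) :
    IsMinOn (proxObj lam φ z) Set.univ (prox lam φ z) :=
  Classical.epsilon_spec (h.exists_isMinOn_proxObj hlam hlamρ z)

lemma ClosedWeaklyConvex.prox_mem (h : ClosedWeaklyConvex ρ φ) (hlam : 0 < lam)
    (hlamρ : lam * ρ < 1) (z : EuclideanSpace ℝ (Fin d)) : prox lam φ z ∈ dom φ := by
  obtain ⟨x₀, hx₀⟩ := h.proper.2
  intro htop
  have := h.prox_isMinOn hlam hlamρ z (Set.mem_univ x₀)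
  simp only [Set.mem_ofPred_eq, proxObj, htop, EReal.top_add_coe] at this
  rw [← h.coe_toReal hx₀, ← EReal.coe_add] at this
  exact absurd (top_le_iff.1 this) (EReal.coe_ne_top _)

lemma nonneg_of_forall_add_mul_nonneg {A B : ℝ} (h : ∀ t : ℝ, 0 < t → t ≤ 1 → 0 ≤ A + t * B) :
    0 ≤ A := by
  by_contra! hA
  have hB : 0 < |B| + 1 := by positivity
  have ht : 0 < min 1 (-A / (2 * (|B| + 1))) := lt_min one_pos (by
    apply div_pos <;> linarith)
  have := h _ ht (min_le_left _ _)
  have h2 : min 1 (-A / (2 * (|B| + 1))) * B ≤ -A / (2 * (|B| + 1)) * (|B| + 1) := by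
    calc _ ≤ min 1 (-A / (2 * (|B| + 1))) * (|B| + 1) := by
          gcongr; linarith [le_abs_self B]
      _ ≤ _ := by gcongr; exact min_le_right _ _
  have h3 : -A / (2 * (|B| + 1)) * (|B| + 1) = -A / 2 := by field_simp
  linarith

/-- The minimizer is compared with points of the segment towards `y`; dividing by `t` and letting `t
→ 0` removes the second-order terms. Apart from `prox_mem`, this is the only property of the prox
used later. -/
lemma ClosedWeaklyConvex.prox_subgradient (h : ClosedWeaklyConvex ρ φ) (hlam : 0 < lam)
    (hlamρ : lam * ρ < 1) (z : EuclideanSpace ℝ (Fin d)) {y} (hy : y ∈ dom φ) :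
    (φ (prox lam φ z)).toReal + lam⁻¹ * inner ℝ (z - prox lam φ z) (y - prox lam φ z)
      - ρ / 2 * ‖y - prox lam φ z‖ ^ 2 ≤ (φ y).toReal := by
  have hx := h.prox_mem hlam hlamρ z
  have hmin := h.prox_isMinOn hlam hlamρ z
  set x := prox lam φ z
  suffices 0 ≤ ((φ y).toReal - (φ x).toReal - lam⁻¹ * inner ℝ (z - x) (y - x)
      + ρ / 2 * ‖y - x‖ ^ 2) by linarith
  refine nonneg_of_forall_add_mul_nonneg (B := lam⁻¹ / 2 * ‖y - x‖ ^ 2 - ρ / 2 * ‖y - x‖ ^ 2)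
    fun t ht0 ht1 => ?_
  have hm := hmin (Set.mem_univ ((1 - t) • x + t • y))
  have hmem := h.lineMap_mem hx hy ht0.le ht1
  simp only [Set.mem_ofPred_eq, proxObj] at hm
  rw [← h.coe_toReal hx, ← h.coe_toReal hmem, ← EReal.coe_add, ← EReal.coe_add,
    EReal.coe_le_coe_iff] at hm
  have hle := h.lineMap_le hx hy ht0.le ht1
  have e : ‖z - ((1 - t) • x + t • y)‖ ^ 2
      = ‖z - x‖ ^ 2 - 2 * t * inner ℝ (z - x) (y - x) + t ^ 2 * ‖y - x‖ ^ 2 := by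
    have : z - ((1 - t) • x + t • y) = (z - x) - t • (y - x) := by module
    rw [this, norm_sub_sq_real, real_inner_smul_right, norm_smul, mul_pow, Real.norm_eq_abs,
      sq_abs]
    ring
  rw [e] at hm
  have hl : 1 / (2 * lam) = lam⁻¹ / 2 := by field_simp
  rw [hl] at hm
  have : 0 ≤ t * ((φ y).toReal - (φ x).toReal - lam⁻¹ * inner ℝ (z - x) (y - x)
      + ρ / 2 * ‖y - x‖ ^ 2 + t * (lam⁻¹ / 2 * ‖y - x‖ ^ 2 - ρ / 2 * ‖y - x‖ ^ 2)) := by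
    linarith
  exact nonneg_of_mul_nonneg_right this ht0

/-- Add the subgradient inequalities at the two prox points, each tested at the other; the two
losses `ρ/2` add up to `ρ`. -/
lemma ClosedWeaklyConvex.prox_cocoercive (h : ClosedWeaklyConvex ρ φ) (hlam : 0 < lam)
    (hlamρ : lam * ρ < 1) (z z' : EuclideanSpace ℝ (Fin d)) :
    (1 - lam * ρ) * ‖prox lam φ z' - prox lam φ z‖ ^ 2
      ≤ inner ℝ (z' - z) (prox lam φ z' - prox lam φ z) := by
  have h1 := h.prox_subgradient hlam hlamρ z (h.prox_mem hlam hlamρ z')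
  have h2 := h.prox_subgradient hlam hlamρ z' (h.prox_mem hlam hlamρ z)
  set x := prox lam φ z
  set x' := prox lam φ z'
  have e : inner ℝ (z' - x') (x - x') = - inner ℝ (z' - x') (x' - x) := by
    rw [← neg_sub x' x, inner_neg_right]
  have e2 : inner ℝ (z' - z) (x' - x) = inner ℝ (z' - x') (x' - x) - inner ℝ (z - x) (x' - x)
      + ‖x' - x‖ ^ 2 := by
    rw [← real_inner_self_eq_norm_sq, ← inner_sub_left, ← inner_add_left]
    congr 1; abel
  rw [e, norm_sub_rev x x'] at h2
  have h3 : lam⁻¹ * (inner ℝ (z - x) (x' - x) - inner ℝ (z' - x') (x' - x))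
      ≤ ρ * ‖x' - x‖ ^ 2 := by linarith
  rw [inv_mul_le_iff₀ hlam] at h3
  rw [e2]
  linarith

lemma ClosedWeaklyConvex.prox_lipschitz (h : ClosedWeaklyConvex ρ φ) (hlam : 0 < lam)
    (hlamρ : lam * ρ < 1) (z z' : EuclideanSpace ℝ (Fin d)) :
    (1 - lam * ρ) * ‖prox lam φ z' - prox lam φ z‖ ≤ ‖z' - z‖ := by
  have h1 := (h.prox_cocoercive hlam hlamρ z z').trans (real_inner_le_norm _ _)
  rcases (norm_nonneg (prox lam φ z' - prox lam φ z)).eq_or_lt with h0 | h0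
  · rw [← h0]; simp
  · refine le_of_mul_le_mul_right ?_ h0
    linarith

/-! ### Functions with Lipschitz continuous gradient on a convex set -/

/-- `g` is differentiable at every point of `s`, and its gradient is `L`-Lipschitz on `s`. -/
structure SmoothOn (L : ℝ) (g : EuclideanSpace ℝ (Fin d) → ℝ) (s : Set (EuclideanSpace ℝ (Fin d))) :
    Prop where
  diff : ∀ w ∈ s, DifferentiableAt ℝ g w
  lip : ∀ w ∈ s, ∀ v ∈ s, ‖gradient g w - gradient g v‖ ≤ L * ‖w - v‖

lemma gradient_fun_neg (g : EuclideanSpace ℝ (Fin d) → ℝ) (x : EuclideanSpace ℝ (Fin d)) :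
    gradient (fun x => - g x) x = - gradient g x := by
  simp only [gradient, fderiv_fun_neg, map_neg]

lemma SmoothOn.neg {L : ℝ} {g : EuclideanSpace ℝ (Fin d) → ℝ} {s : Set (EuclideanSpace ℝ (Fin d))}
    (h : SmoothOn L g s) : SmoothOn L (fun x => - g x) s := by
  refine ⟨fun w hw => (h.diff w hw).neg, fun w hw v hv => ?_⟩
  rw [gradient_fun_neg, gradient_fun_neg, neg_sub_neg, norm_sub_rev]
  exact h.lip w hw v hv

lemma SmoothOn.le_add {L : ℝ} {g : EuclideanSpace ℝ (Fin d) → ℝ}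
    {s : Set (EuclideanSpace ℝ (Fin d))} (h : SmoothOn L g s) (hs : Convex ℝ s) {x y} (hx : x ∈ s)
    (hy : y ∈ s) : g y ≤ g x + inner ℝ (gradient g x) (y - x) + L / 2 * ‖y - x‖ ^ 2 := by
  have hmem : ∀ t ∈ Set.Icc (0 : ℝ) 1, x + t • (y - x) ∈ s := fun t ht =>
    hs.add_smul_sub_mem hx hy ht
  -- The Lipschitz bound along the segment makes `u` nonincreasing, and `u 1 ≤ u 0` is the claim.
  set u : ℝ → ℝ := fun t => g (x + t • (y - x)) - t * inner ℝ (gradient g x) (y - x)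
    - L / 2 * ‖y - x‖ ^ 2 * t ^ 2
  have hd : ∀ t ∈ Set.Icc (0 : ℝ) 1, HasDerivAt u
      (inner ℝ (gradient g (x + t • (y - x))) (y - x) - inner ℝ (gradient g x) (y - x)
        - L / 2 * ‖y - x‖ ^ 2 * (2 * t)) t := by
    intro t ht
    have h1 : HasDerivAt (fun t : ℝ => x + t • (y - x)) (y - x) t := by
      simpa using ((hasDerivAt_id t).smul_const (y - x)).const_add x
    have h2 := (h.diff _ (hmem t ht)).hasGradientAt.hasFDerivAt.comp_hasDerivAt t h1
    have h3 := (h2.sub ((hasDerivAt_id t).mul_const (inner ℝ (gradient g x) (y - x)))).sub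
      (((hasDerivAt_id t).pow 2).const_mul (L / 2 * ‖y - x‖ ^ 2))
    refine h3.congr_deriv ?_
    simp
  have hanti : AntitoneOn u (Set.Icc 0 1) := by
    apply antitoneOn_of_deriv_nonpos (convex_Icc 0 1)
    · exact fun t ht => (hd t ht).continuousAt.continuousWithinAt
    · intro t ht
      rw [interior_Icc] at ht
      exact (hd t (Set.Ioo_subset_Icc_self ht)).differentiableAt.differentiableWithinAt
    · intro t ht
      rw [interior_Icc] at ht
      have ht' := Set.Ioo_subset_Icc_self ht
      rw [(hd t ht').deriv, ← inner_sub_left]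
      have h1 := real_inner_le_norm (gradient g (x + t • (y - x)) - gradient g x) (y - x)
      have h2 := h.lip _ (hmem t ht') x hx
      rw [add_sub_cancel_left, norm_smul, Real.norm_of_nonneg ht'.1] at h2
      have h3 := mul_le_mul_of_nonneg_right h2 (norm_nonneg (y - x))
      nlinarith
  have := hanti (Set.left_mem_Icc.2 zero_le_one) (Set.right_mem_Icc.2 zero_le_one) zero_le_one
  simp only [u, one_smul, zero_smul, add_zero, add_sub_cancel, one_mul, zero_mul, sub_zero,
    one_pow, mul_one, ne_eq, OfNat.ofNat_ne_zero, not_false_eq_true, zero_pow, mul_zero] at this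
  linarith

lemma SmoothOn.sub_le {L : ℝ} {g : EuclideanSpace ℝ (Fin d) → ℝ}
    {s : Set (EuclideanSpace ℝ (Fin d))} (h : SmoothOn L g s) (hs : Convex ℝ s) {x y} (hx : x ∈ s)
    (hy : y ∈ s) : g x + inner ℝ (gradient g x) (y - x) - L / 2 * ‖y - x‖ ^ 2 ≤ g y := by
  have := h.neg.le_add hs hx hy
  rw [gradient_fun_neg, inner_neg_left] at this
  linarith

lemma hasGradientAt_avg {f : Fin n → EuclideanSpace ℝ (Fin d) → ℝ} {w : EuclideanSpace ℝ (Fin d)}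
    (h : ∀ i, DifferentiableAt ℝ (f i) w) :
    HasGradientAt (avg f) ((1 / (n : ℝ)) • ∑ i, gradient (f i) w) w := by
  rw [hasGradientAt_iff_hasFDerivAt]
  have := (HasFDerivAt.fun_sum (u := Finset.univ)
    (fun i _ => (h i).hasGradientAt.hasFDerivAt)).const_mul (1 / (n : ℝ))
  refine this.congr_fderiv ?_
  simp [map_sum]

lemma SmoothOn.avg {L : ℝ} {f : Fin n → EuclideanSpace ℝ (Fin d) → ℝ}
    {s : Set (EuclideanSpace ℝ (Fin d))} (hn : 0 < n) (h : ∀ i, SmoothOn L (f i) s) :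
    SmoothOn L (avg f) s := by
  refine ⟨fun w hw => (hasGradientAt_avg fun i => (h i).diff w hw).differentiableAt,
    fun w hw v hv => ?_⟩
  rw [(hasGradientAt_avg fun i => (h i).diff w hw).gradient,
    (hasGradientAt_avg fun i => (h i).diff v hv).gradient, ← smul_sub, ← Finset.sum_sub_distrib,
    norm_smul, Real.norm_of_nonneg (by positivity)]
  have hn' : (0 : ℝ) < n := by exact_mod_cast hn
  have : ‖∑ i, (gradient (f i) w - gradient (f i) v)‖ ≤ n * (L * ‖w - v‖) := by
    refine (norm_sum_le_of_le _ fun i _ => (h i).lip w hw v hv).trans (by simp)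
  calc 1 / (n : ℝ) * ‖∑ i, (gradient (f i) w - gradient (f i) v)‖
      ≤ 1 / (n : ℝ) * (n * (L * ‖w - v‖)) := by gcongr
    _ = _ := by field_simp

/-! ### The composite problem -/

/-- The standing assumptions on `ψ = f + φ`. -/
structure CompositeProblem (L ρ : ℝ) (f : Fin n → EuclideanSpace ℝ (Fin d) → ℝ)
    (φ : EuclideanSpace ℝ (Fin d) → EReal) : Prop where
  n_pos : 0 < n
  L_pos : 0 < L
  rho_nonneg : 0 ≤ ρ
  smooth : ∀ i, SmoothOn L (f i) (dom φ)
  reg : ClosedWeaklyConvex ρ φ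

/-- The real values of `ψ` on `dom φ`. -/
noncomputable def objReal (f : Fin n → EuclideanSpace ℝ (Fin d) → ℝ) (φ : EuclideanSpace ℝ (Fin d) → EReal)
    (w : EuclideanSpace ℝ (Fin d)) : ℝ :=
  avg f w + (φ w).toReal

variable {f : Fin n → EuclideanSpace ℝ (Fin d) → ℝ} {L μ p : ℝ}

namespace CompositeProblem

lemma smooth_avg (h : CompositeProblem L ρ f φ) : SmoothOn L (avg f) (dom φ) :=
  SmoothOn.avg h.n_pos h.smooth

lemma convex_dom (h : CompositeProblem L ρ f φ) : Convex ℝ (dom φ) := h.reg.weak.1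

lemma objective_eq (h : CompositeProblem L ρ f φ) {w} (hw : w ∈ dom φ) :
    objective f φ w = (objReal f φ w : EReal) := by
  rw [objective, objReal, EReal.coe_add, h.reg.coe_toReal hw]

lemma objective_eq_top {w} (hw : w ∉ dom φ) : objective f φ w = ⊤ := by
  have : φ w = ⊤ := not_not.1 hw
  rw [objective, this, EReal.coe_add_top]

lemma exists_optVal_eq (h : CompositeProblem L ρ f φ) (hW : (optSet (objective f φ)).Nonempty) :
    ∃ p : ℝ, optVal (objective f φ) = p ∧ (∀ w ∈ dom φ, p ≤ objReal f φ w) ∧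
      ∀ w ∈ dom φ, objReal f φ w = p → w ∈ optSet (objective f φ) := by
  obtain ⟨w₀, hw₀⟩ := hW
  have hw₀' : objective f φ w₀ = optVal (objective f φ) := hw₀
  have hle : ∀ w, optVal (objective f φ) ≤ objective f φ w := fun w => iInf_le _ w
  have hd : w₀ ∈ dom φ := by
    by_contra hnd
    obtain ⟨v, hv⟩ := h.reg.proper.2
    have := hle v
    rw [← hw₀', objective_eq_top hnd, h.objective_eq hv] at this
    exact absurd (top_le_iff.1 this) (EReal.coe_ne_top _)
  have hp : optVal (objective f φ) = (objReal f φ w₀ : EReal) := by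
    rw [← hw₀', h.objective_eq hd]
  refine ⟨objReal f φ w₀, hp, fun w hw => ?_, fun w hw he => ?_⟩
  · have := hle w
    rwa [hp, h.objective_eq hw, EReal.coe_le_coe_iff] at this
  · change objective f φ w = _
    rw [hp, h.objective_eq hw, he]

lemma normalMap_le (h : CompositeProblem L ρ f φ) (hlam : 0 < lam) (hlamρ : lam * ρ < 1)
    (z : EuclideanSpace ℝ (Fin d)) {y} (hy : y ∈ dom φ) :
    objReal f φ (prox lam φ z) + inner ℝ (normalMap lam f φ z) (y - prox lam φ z)
      - (L + ρ) / 2 * ‖y - prox lam φ z‖ ^ 2 ≤ objReal f φ y := by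
  have h1 := h.reg.prox_subgradient hlam hlamρ z hy
  have h2 := h.smooth_avg.sub_le h.convex_dom (h.reg.prox_mem hlam hlamρ z) hy
  rw [normalMap, inner_add_left, real_inner_smul_left, objReal, objReal]
  linarith

/-- The quadratic remainder in `normalMap_le` is `o(‖y - x‖)`, and outside `dom φ` there is nothing
to show. -/
lemma normalMap_mem_subdiff (h : CompositeProblem L ρ f φ) (hlam : 0 < lam)
    (hlamρ : lam * ρ < 1) (z : EuclideanSpace ℝ (Fin d)) :
    normalMap lam f φ z ∈ subdiff (objective f φ) (prox lam φ z) := by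
  have hx := h.reg.prox_mem hlam hlamρ z
  refine ⟨?_, fun ε hε => ?_⟩
  · change objective f φ _ ≠ ⊤
    rw [h.objective_eq hx]; exact EReal.coe_ne_top _
  have hq : 0 < (L + ρ) / 2 := by linarith [h.L_pos, h.rho_nonneg]
  filter_upwards [Metric.ball_mem_nhds (prox lam φ z) (div_pos hε hq)] with y hy
  by_cases hyd : y ∈ dom φ
  · rw [h.objective_eq hx, h.objective_eq hyd, ← EReal.coe_add, EReal.coe_le_coe_iff]
    have h1 := h.normalMap_le hlam hlamρ z hyd
    rw [Metric.mem_ball, dist_eq_norm, lt_div_iff₀ hq] at hy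
    have h2 := mul_le_mul_of_nonneg_right hy.le (norm_nonneg (y - prox lam φ z))
    nlinarith
  · rw [objective_eq_top hyd]; exact le_top

/-- The norm of one particular subgradient dominates the distance from `0` to `∂ψ`. Beyond `μ > 0`,
PL enters the proof only through this lemma. -/
lemma le_norm_normalMap_sq (h : CompositeProblem L ρ f φ) (hlam : 0 < lam)
    (hlamρ : lam * ρ < 1) (hPL : PLCondition μ (objective f φ))
    (hp : optVal (objective f φ) = p) (z : EuclideanSpace ℝ (Fin d)) :
    2 * μ * (objReal f φ (prox lam φ z) - p) ≤ ‖normalMap lam f φ z‖ ^ 2 := by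
  have h1 := hPL.2 (prox lam φ z)
  rw [hp, h.objective_eq (h.reg.prox_mem hlam hlamρ z), ← EReal.coe_sub, ← EReal.coe_mul] at h1
  have h2 : Metric.infEDist 0 (subdiff (objective f φ) (prox lam φ z)) ^ 2
      ≤ ENNReal.ofReal (‖normalMap lam f φ z‖ ^ 2) := by
    rw [ENNReal.ofReal_pow (norm_nonneg _), ofReal_norm]
    gcongr
    refine (Metric.infEDist_le_edist_of_mem (h.normalMap_mem_subdiff hlam hlamρ z)).trans ?_
    rw [edist_comm, edist_zero_right]
  have h3 := h1.trans (EReal.coe_ennreal_le_coe_ennreal_iff.2 h2)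
  rwa [EReal.coe_ennreal_ofReal, max_eq_left (by positivity), EReal.coe_le_coe_iff] at h3

/-- Nothing is known about `f` outside `dom φ`. At a point outside the domain, `f` is therefore
replaced on nearby domain points by the quadratic minorant based at a fixed `v ∈ dom φ`, which is
continuous everywhere. -/
lemma lsc_objective (h : CompositeProblem L ρ f φ) : LowerSemicontinuous (objective f φ) := by
  have hadd : ∀ (q : EuclideanSpace ℝ (Fin d) → ℝ) (x), ContinuousAt q x →
      LowerSemicontinuousAt (fun w => (q w : EReal) + φ w) x := by
    intro q x hq
    refine LowerSemicontinuousAt.add' ?_ (h.reg.lsc x) ?_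
    · exact (continuous_coe_real_ereal.continuousAt.comp hq).lowerSemicontinuousAt
    · apply EReal.continuousAt_add
      · left; exact EReal.coe_ne_top _
      · left; exact EReal.coe_ne_bot _
  intro x
  by_cases hx : x ∈ dom φ
  · exact hadd _ x (h.smooth_avg.diff x hx).continuousAt
  · obtain ⟨v, hv⟩ := h.reg.proper.2
    have hq := hadd (fun y => avg f v + inner ℝ (gradient (avg f) v) (y - v)
      - L / 2 * ‖y - v‖ ^ 2) x (by fun_prop)
    intro c hc
    rw [objective_eq_top hx] at hc
    have hxt : φ x = ⊤ := not_not.1 hx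
    filter_upwards [hq c (by simpa only [hxt, EReal.coe_add_top] using hc)] with y hy
    by_cases hyd : y ∈ dom φ
    · refine hy.trans_le ?_
      rw [objective]
      gcongr
      exact h.smooth_avg.sub_le h.convex_dom hv hyd
    · rw [objective_eq_top hyd]
      exact hc

/-- A proximal gradient step with a small step size decreases `√(ψ - ψ*)` at least proportionally
to the length of the step. -/
lemma exists_prox_step (h : CompositeProblem L ρ f φ) (hPL : PLCondition μ (objective f φ))
    (hp : optVal (objective f φ) = p) (hmin : ∀ w ∈ dom φ, p ≤ objReal f φ w) {c : ℝ}
    (hc : 0 < c) (hcμ : c ^ 2 < μ / 2) {y} (hy : y ∈ dom φ) :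
    ∃ x ∈ dom φ, √(objReal f φ x - p) + c * ‖x - y‖ ≤ √(objReal f φ y - p) ∧
      (objReal f φ y ≤ objReal f φ x → objReal f φ y = p) := by
  have hμ := hPL.1
  -- The restriction `c ^ 2 < μ / 2` is exactly `θ < 1`.
  set θ := 2 * c / √(2 * μ) with hθ
  have hsq : 0 < √(2 * μ) := Real.sqrt_pos.2 (by linarith)
  have hθ1 : θ < 1 := by
    rw [hθ, div_lt_one hsq]
    apply Real.lt_sqrt_of_sq_lt
    nlinarith
  have hθ0 : 0 < θ := by positivity
  -- `s` is the inverse step size. As `θ < 1`, a large `s` makes the decrease `(s - (L + ρ) / 2) ‖x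
  -- - y‖²` exceed the terms `θ (L + s) ‖x - y‖²` and `c² ‖x - y‖²` that arise from squaring `√(ψ x
  -- - p) + c ‖x - y‖`.
  obtain ⟨s, hs⟩ : ∃ s : ℝ, max (ρ + 1) ((θ * L + c ^ 2 + (L + ρ) / 2 + 1) / (1 - θ)) < s :=
    exists_gt _
  obtain ⟨hs1, hs2⟩ := max_lt_iff.1 hs
  rw [div_lt_iff₀ (by linarith)] at hs2
  have hspos : 0 < s := by linarith [h.rho_nonneg]
  have hl : 0 < s⁻¹ := inv_pos.2 hspos
  have hlρ : s⁻¹ * ρ < 1 := by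
    rw [inv_mul_lt_iff₀ hspos]; linarith
  set z := y - s⁻¹ • gradient (avg f) y with hz
  have hx := h.reg.prox_mem hl hlρ z
  have hsub := h.reg.prox_subgradient hl hlρ z hy
  have hPLz := h.le_norm_normalMap_sq hl hlρ hPL hp z
  have hlip := h.smooth_avg.lip _ hx y hy
  rw [normalMap] at hPLz
  set x := prox s⁻¹ φ z
  have hzx : s • (z - x) = s • (y - x) - gradient (avg f) y := by
    rw [hz, smul_sub, smul_sub, smul_sub, smul_inv_smul₀ hspos.ne']
    abel
  rw [inv_inv] at hsub hPLz
  have hin : s * inner ℝ (z - x) (y - x) = s * ‖x - y‖ ^ 2 + inner ℝ (gradient (avg f) y) (x - y) := by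
    rw [← real_inner_smul_left, hzx, inner_sub_left, real_inner_smul_left,
      real_inner_self_eq_norm_sq, norm_sub_rev y x, ← neg_sub y x, inner_neg_right]
    ring
  have hdec : objReal f φ x + (s - (L + ρ) / 2) * ‖x - y‖ ^ 2 ≤ objReal f φ y := by
    rw [hin, norm_sub_rev y x] at hsub
    have hlow := h.smooth_avg.le_add h.convex_dom hy hx
    rw [objReal, objReal]
    linarith
  have hFle : ‖gradient (avg f) x + s • (z - x)‖ ≤ (L + s) * ‖x - y‖ := by
    rw [hzx]
    calc ‖gradient (avg f) x + (s • (y - x) - gradient (avg f) y)‖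
        = ‖(gradient (avg f) x - gradient (avg f) y) + s • (y - x)‖ := by congr 1; abel
      _ ≤ ‖gradient (avg f) x - gradient (avg f) y‖ + ‖s • (y - x)‖ := norm_add_le _ _
      _ ≤ L * ‖x - y‖ + s * ‖x - y‖ := by
          rw [norm_smul, Real.norm_of_nonneg hspos.le, norm_sub_rev y x]
          gcongr
      _ = _ := by ring
  have hx0 : 0 ≤ objReal f φ x - p := by linarith [hmin x hx]
  set D := ‖x - y‖
  have hD : 0 ≤ D := norm_nonneg _
  have hr : √(objReal f φ x - p) * √(2 * μ) ≤ (L + s) * D := by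
    rw [← Real.sqrt_mul hx0]
    apply Real.sqrt_le_iff.2
    have := h.L_pos
    refine ⟨by positivity, ?_⟩
    calc (objReal f φ x - p) * (2 * μ) ≤ ‖gradient (avg f) x + s • (z - x)‖ ^ 2 := by linarith
      _ ≤ _ := by gcongr
  have hprod : 2 * c * √(objReal f φ x - p) ≤ θ * ((L + s) * D) := by
    rw [hθ, div_mul_eq_mul_div, le_div_iff₀ hsq]
    have := mul_le_mul_of_nonneg_left hr (by linarith : 0 ≤ 2 * c)
    linarith
  have hgain : 0 < s - (L + ρ) / 2 - θ * (L + s) - c ^ 2 := by linarith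
  refine ⟨x, hx, ?_, fun hle => ?_⟩
  · apply Real.le_sqrt_of_sq_le
    rw [add_sq, Real.sq_sqrt hx0]
    have h1 := mul_le_mul_of_nonneg_right hprod hD
    have h2 := mul_nonneg hgain.le (sq_nonneg D)
    rw [mul_pow]
    linarith
  -- Without decrease the step has length zero, so `x = y` and the normal map vanishes; PL then
  -- forces optimality.
  · have hgain' : 0 < s - (L + ρ) / 2 := by
      have := h.L_pos
      have : 0 < θ * (L + s) := by positivity
      linarith [sq_nonneg c]
    have hD0' : D = 0 := by
      have h0 : (s - (L + ρ) / 2) * D ^ 2 ≤ 0 := by linarith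
      exact pow_eq_zero_iff two_ne_zero |>.1
        (le_antisymm (nonpos_of_mul_nonpos_right h0 hgain') (sq_nonneg D))
    rw [hD0', mul_zero] at hFle
    have hF0 : ‖gradient (avg f) x + s • (z - x)‖ = 0 := le_antisymm hFle (norm_nonneg _)
    rw [hF0] at hPLz
    have : objReal f φ x - p ≤ 0 := by
      by_contra! hpos
      linarith [mul_pos hμ hpos]
    have hyx : x = y := by
      rw [← sub_eq_zero, ← norm_eq_zero]; exact hD0'
    rw [← hyx]
    linarith

/-- The PL inequality implies quadratic growth away from the set of solutions. -/
lemma exists_optimal_near (h : CompositeProblem L ρ f φ) (hPL : PLCondition μ (objective f φ))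
    (hp : optVal (objective f φ) = p) (hmin : ∀ w ∈ dom φ, p ≤ objReal f φ w) {c : ℝ}
    (hc : 0 < c) (hcμ : c ^ 2 < μ / 2) {w} (hw : w ∈ dom φ) :
    ∃ y ∈ dom φ, objReal f φ y = p ∧ c * ‖y - w‖ ≤ √(objReal f φ w - p) := by
  set r := √(objReal f φ w - p) with hr
  -- This is the set `√(ψ y - p) + c ‖y - w‖ ≤ r`, written without the root so that closedness
  -- follows from lower semicontinuity.
  set S := (fun y => objective f φ y + ((-(r - c * ‖y - w‖) ^ 2 : ℝ) : EReal)) ⁻¹' Set.Iic (p : EReal)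
    ∩ {y | c * ‖y - w‖ ≤ r} with hS
  have hmemS : ∀ y ∈ dom φ, (y ∈ S ↔ √(objReal f φ y - p) + c * ‖y - w‖ ≤ r) := by
    intro y hy
    have hy0 : 0 ≤ objReal f φ y - p := by linarith [hmin y hy]
    simp only [hS, Set.mem_inter_iff, Set.mem_preimage, Set.mem_Iic, Set.mem_ofPred_eq]
    rw [h.objective_eq hy, ← EReal.coe_add, EReal.coe_le_coe_iff, 
      ← le_sub_iff_add_le (a := √(objReal f φ y - p)), Real.sqrt_le_iff]
    constructor
    · rintro ⟨h1, h2⟩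
      exact ⟨by linarith, by linarith⟩
    · rintro ⟨h1, h2⟩
      exact ⟨by linarith, by linarith⟩
  have hSdom : S ⊆ dom φ := by
    rintro y ⟨hy, -⟩
    by_contra hyd
    simp only [Set.mem_preimage, objective_eq_top hyd, EReal.top_add_coe, Set.mem_Iic] at hy
    exact absurd (top_le_iff.1 hy) (EReal.coe_ne_top _)
  have hclosed : IsClosed S := by
    refine IsClosed.inter (LowerSemicontinuous.isClosed_preimage ?_ _)
      (isClosed_le (by fun_prop) continuous_const)
    refine LowerSemicontinuous.add' h.lsc_objective ?_ ?_
    · apply Continuous.lowerSemicontinuous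
      exact continuous_coe_real_ereal.comp (by fun_prop)
    · intro x
      apply EReal.continuousAt_add
      · right; exact EReal.coe_ne_bot _
      · right; exact EReal.coe_ne_top _
  have hbdd : S ⊆ Metric.closedBall w (r / c) := by
    rintro y ⟨-, hy⟩
    rw [Metric.mem_closedBall, dist_eq_norm, le_div_iff₀ hc, mul_comm]
    exact hy
  have hwS : w ∈ S := by
    rw [hmemS w hw]; simp [hr]
  obtain ⟨y, hyS, hymin⟩ := (h.lsc_objective.lowerSemicontinuousOn S).exists_isMinOn ⟨w, hwS⟩
    ((isCompact_closedBall _ _).of_isClosed_subset hclosed hbdd)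
  have hyd := hSdom hyS
  obtain ⟨x, hxd, hstep, hopt⟩ := h.exists_prox_step hPL hp hmin hc hcμ hyd
  -- By the triangle inequality a prox step does not leave `S`, so from the minimizer `y` of `ψ`
  -- over `S` it cannot decrease `ψ`.
  have hxS : x ∈ S := by
    rw [hmemS x hxd]
    have h1 := (hmemS y hyd).1 hyS
    have h2 : c * ‖x - w‖ ≤ c * ‖x - y‖ + c * ‖y - w‖ := by
      rw [← mul_add]; gcongr; exact norm_sub_le_norm_sub_add_norm_sub x y w
    linarith
  refine ⟨y, hyd, hopt ?_, hyS.2⟩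
  have := hymin hxS
  simp only [Set.mem_ofPred_eq] at this
  rwa [h.objective_eq hyd, h.objective_eq hxd, EReal.coe_le_coe_iff] at this

end CompositeProblem

/-! ### Sums of vectors and random permutations -/

section Sums

variable {V : Type*} [NormedAddCommGroup V]

lemma norm_sum_sq_le_card_mul {ι : Type*} (s : Finset ι) (u : ι → V) :
    ‖∑ i ∈ s, u i‖ ^ 2 ≤ s.card * ∑ i ∈ s, ‖u i‖ ^ 2 :=
  (by gcongr; exact norm_sum_le _ _ : ‖∑ i ∈ s, u i‖ ^ 2 ≤ (∑ i ∈ s, ‖u i‖) ^ 2).trans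
    sq_sum_le_card_mul_sum_sq

lemma sum_range_cast_le (n : ℕ) : ∑ i ∈ Finset.range n, (i : ℝ) ≤ (n : ℝ) ^ 2 / 2 := by
  induction n with
  | zero => simp
  | succ k ih => rw [Finset.sum_range_succ]; push_cast; nlinarith

lemma sum_range_cast_sq_le (n : ℕ) : ∑ i ∈ Finset.range n, (i : ℝ) ^ 2 ≤ (n : ℝ) ^ 3 / 3 := by
  induction n with
  | zero => simp
  | succ k ih =>
    rw [Finset.sum_range_succ]; push_cast
    have : (0 : ℝ) ≤ k := k.cast_nonneg
    nlinarith

/-- Extension by zero of a family indexed by `Fin n` to a sequence. -/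
noncomputable def extendZero (u : Fin n → V) (j : ℕ) : V := if h : j < n then u ⟨j, h⟩ else 0

lemma extendZero_of_lt (u : Fin n → V) {j : ℕ} (h : j < n) : extendZero u j = u ⟨j, h⟩ :=
  dif_pos h

lemma sum_range_extendZero (u : Fin n → V) : ∑ j ∈ Finset.range n, extendZero u j = ∑ i, u i := by
  rw [Finset.sum_range]
  exact Finset.sum_congr rfl fun i _ => extendZero_of_lt u i.2

lemma sum_range_extendZero_norm_sq (u : Fin n → V) :
    ∑ j ∈ Finset.range n, ‖extendZero u j‖ ^ 2 = ∑ i, ‖u i‖ ^ 2 := by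
  rw [Finset.sum_range]
  exact Finset.sum_congr rfl fun i _ => by rw [extendZero_of_lt u i.2]

/-- The sum of the squared norms of the partial sums of `u`. -/
noncomputable def partialSumsSq (u : Fin n → V) : ℝ :=
  ∑ i ∈ Finset.range n, ‖∑ j ∈ Finset.range i, extendZero u j‖ ^ 2

lemma partialSumsSq_perm_le (u : Fin n → V) (σ : Equiv.Perm (Fin n)) :
    2 * partialSumsSq (u ∘ σ) ≤ (n : ℝ) ^ 2 * ∑ i, ‖u i‖ ^ 2 := by
  set W := ∑ i, ‖u i‖ ^ 2 with hW
  have hW0 : 0 ≤ W := Finset.sum_nonneg fun _ _ => by positivity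
  have h1 : ∀ i ∈ Finset.range n, ‖∑ j ∈ Finset.range i, extendZero (u ∘ σ) j‖ ^ 2 ≤ i * W := by
    intro i hi
    refine (norm_sum_sq_le_card_mul _ _).trans ?_
    rw [Finset.card_range]
    gcongr
    calc ∑ j ∈ Finset.range i, ‖extendZero (u ∘ σ) j‖ ^ 2
        ≤ ∑ j ∈ Finset.range n, ‖extendZero (u ∘ σ) j‖ ^ 2 :=
          Finset.sum_le_sum_of_subset_of_nonneg
            (Finset.range_mono (Finset.mem_range.1 hi).le) fun _ _ _ => by positivity
      _ = W := by
          rw [sum_range_extendZero_norm_sq, hW]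
          exact Equiv.sum_comp σ fun i => ‖u i‖ ^ 2
  have h2 : partialSumsSq (u ∘ σ) ≤ ∑ i ∈ Finset.range n, (i : ℝ) * W := Finset.sum_le_sum h1
  rw [← Finset.sum_mul] at h2
  nlinarith [mul_le_mul_of_nonneg_right (sum_range_cast_le n) hW0]

/-- Composing with a transposition shows that the sum does not depend on the position `j`; summing
over all positions gives the right side. -/
lemma sum_perm_norm_sq (u : Fin n → V) (j : Fin n) :
    n * ∑ σ : Equiv.Perm (Fin n), ‖u (σ j)‖ ^ 2 = n.factorial * ∑ i, ‖u i‖ ^ 2 := by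
  have hsymm : ∀ k ∈ (Finset.univ : Finset (Fin n)),
      ∑ σ : Equiv.Perm (Fin n), ‖u (σ k)‖ ^ 2 = ∑ σ : Equiv.Perm (Fin n), ‖u (σ j)‖ ^ 2 := by
    intro k _
    rw [← Equiv.sum_comp (Equiv.mulRight (Equiv.swap j k))]
    exact Finset.sum_congr rfl fun σ _ => by simp
  have h1 := Finset.sum_congr (rfl : (Finset.univ : Finset (Fin n)) = _) hsymm
  rw [Finset.sum_const, Finset.card_univ, Fintype.card_fin, nsmul_eq_mul, Finset.sum_comm] at h1
  rw [← h1, Finset.sum_congr rfl fun (σ : Equiv.Perm (Fin n)) _ =>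
    Equiv.sum_comp σ fun i => ‖u i‖ ^ 2]
  simp [Fintype.card_perm]

variable [InnerProductSpace ℝ V]

lemma norm_add_sq_le_two_mul (a b : V) : ‖a + b‖ ^ 2 ≤ 2 * ‖a‖ ^ 2 + 2 * ‖b‖ ^ 2 := by
  have := parallelogram_law_with_norm ℝ a b
  nlinarith [mul_self_nonneg ‖a - b‖]

lemma sum_norm_sub_mean_sq_le (u : Fin n → V) {m : V} (hm : (n : ℝ) • m = ∑ i, u i) :
    ∑ i, ‖u i - m‖ ^ 2 ≤ ∑ i, ‖u i‖ ^ 2 := by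
  have h1 : ∑ i, ‖u i - m‖ ^ 2 = ∑ i, ‖u i‖ ^ 2 - n * ‖m‖ ^ 2 := by
    simp_rw [norm_sub_sq_real, Finset.sum_add_distrib, Finset.sum_sub_distrib, ← Finset.mul_sum,
      ← sum_inner, ← hm, real_inner_smul_left, real_inner_self_eq_norm_sq]
    simp
    ring
  have : 0 ≤ (n : ℝ) * ‖m‖ ^ 2 := by positivity
  linarith

/-- By symmetry all positions `k' ≠ j` give the same value. Together with the nonnegative diagonal
value they sum to `0`, because `∑ u = 0`. -/
lemma sum_perm_inner_nonpos {u : Fin n → V} (hu : ∑ i, u i = 0) {j k : Fin n} (hjk : j ≠ k) :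
    ∑ σ : Equiv.Perm (Fin n), inner ℝ (u (σ j)) (u (σ k)) ≤ 0 := by
  set A : Fin n → ℝ := fun k => ∑ σ : Equiv.Perm (Fin n), inner ℝ (u (σ j)) (u (σ k)) with hA
  have hsymm : ∀ k' ∈ Finset.univ.erase j, A k' = A k := by
    intro k' hk'
    have hk'j : k' ≠ j := Finset.ne_of_mem_erase hk'
    simp only [hA]
    rw [← Equiv.sum_comp (Equiv.mulRight (Equiv.swap k k'))]
    refine Finset.sum_congr rfl fun σ _ => ?_
    simp [Equiv.swap_apply_of_ne_of_ne hjk hk'j.symm]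
  have hsum : ∑ k', A k' = 0 := by
    simp only [hA]
    rw [Finset.sum_comm]
    refine Finset.sum_eq_zero fun σ _ => ?_
    rw [← inner_sum, Equiv.sum_comp σ u, hu, inner_zero_right]
  have hj : 0 ≤ A j := Finset.sum_nonneg fun σ _ => real_inner_self_nonneg
  rw [← Finset.add_sum_erase _ _ (Finset.mem_univ j), Finset.sum_congr rfl hsymm,
    Finset.sum_const, nsmul_eq_mul] at hsum
  have hcard : 0 < (Finset.univ.erase j).card :=
    Finset.card_pos.2 ⟨k, Finset.mem_erase.2 ⟨hjk.symm, Finset.mem_univ k⟩⟩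
  have hcard' : (0 : ℝ) < (Finset.univ.erase j).card := by exact_mod_cast hcard
  change A k ≤ 0
  by_contra! hpos
  nlinarith [mul_pos hcard' hpos]

/-- Sampling without replacement: the second moments of the partial sums of a randomly permuted
family with zero sum. -/
lemma sum_perm_partialSumsSq_le {u : Fin n → V} (hu : ∑ i, u i = 0) :
    2 * ∑ σ : Equiv.Perm (Fin n), partialSumsSq (u ∘ σ)
      ≤ n.factorial * (n * ∑ i, ‖u i‖ ^ 2) := by
  rcases Nat.eq_zero_or_pos n with rfl | hn
  · simp [partialSumsSq]
  have hn' : (0 : ℝ) < n := by exact_mod_cast hn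
  set W := ∑ i, ‖u i‖ ^ 2 with hW
  have hW0 : 0 ≤ W := Finset.sum_nonneg fun _ _ => by positivity
  have hpart : ∀ i ∈ Finset.range n,
      ∑ σ : Equiv.Perm (Fin n), ‖∑ j ∈ Finset.range i, extendZero (u ∘ σ) j‖ ^ 2
        ≤ i * (n.factorial * W / n) := by
    intro i hi
    have hin := Finset.mem_range.1 hi
    simp_rw [← real_inner_self_eq_norm_sq, sum_inner, inner_sum]
    rw [Finset.sum_comm]
    -- Only the diagonal term of each row survives, so the mean squared partial sum is at most `i W
    -- / n`, against the bound `i W` for an arbitrary order.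
    have hrow : ∀ j ∈ Finset.range i, ∑ σ : Equiv.Perm (Fin n), ∑ k ∈ Finset.range i,
        inner ℝ (extendZero (u ∘ σ) j) (extendZero (u ∘ σ) k) ≤ n.factorial * W / n := by
      intro j hj
      have hjn : j < n := (Finset.mem_range.1 hj).trans hin
      rw [Finset.sum_comm, ← Finset.add_sum_erase _ _ hj]
      have hdiag : ∑ σ : Equiv.Perm (Fin n),
          inner ℝ (extendZero (u ∘ σ) j) (extendZero (u ∘ σ) j) = n.factorial * W / n := by
        rw [eq_div_iff hn'.ne', mul_comm, hW, ← sum_perm_norm_sq u ⟨j, hjn⟩]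
        congr 1
        exact Finset.sum_congr rfl fun σ _ => by
          rw [extendZero_of_lt _ hjn, real_inner_self_eq_norm_sq, Function.comp_apply]
      have hoff : ∑ k ∈ (Finset.range i).erase j, ∑ σ : Equiv.Perm (Fin n),
          inner ℝ (extendZero (u ∘ σ) j) (extendZero (u ∘ σ) k) ≤ 0 := by
        refine Finset.sum_nonpos fun k hk => ?_
        have hkn : k < n := (Finset.mem_range.1 (Finset.mem_of_mem_erase hk)).trans hin
        have hne : (⟨j, hjn⟩ : Fin n) ≠ ⟨k, hkn⟩ := fun he =>
          Finset.ne_of_mem_erase hk (Fin.mk.inj_iff.1 he).symm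
        simp_rw [extendZero_of_lt _ hjn, extendZero_of_lt _ hkn, Function.comp_apply]
        exact sum_perm_inner_nonpos hu hne
      linarith
    calc _ ≤ ∑ j ∈ Finset.range i, n.factorial * W / n := Finset.sum_le_sum hrow
      _ = _ := by simp
  have htot : ∑ σ : Equiv.Perm (Fin n), partialSumsSq (u ∘ σ)
      ≤ (n : ℝ) ^ 2 / 2 * (n.factorial * W / n) := by
    simp only [partialSumsSq]
    rw [Finset.sum_comm]
    refine (Finset.sum_le_sum hpart).trans ?_
    rw [← Finset.sum_mul]
    gcongr
    exact sum_range_cast_le n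
  have e : (n : ℝ) ^ 2 / 2 * (n.factorial * W / n) = n.factorial * (n * W) / 2 := by
    field_simp
  linarith

/-- A perturbed incremental method stays close to the method with frozen increments. -/
lemma norm_sq_incremental_error_le {y G g : ℕ → V} {z : V} {a K : ℝ} (ha : 0 ≤ a) {n : ℕ}
    (h0 : y 0 = z) (hsucc : ∀ j < n, y (j + 1) = y j - a • G j)
    (hG : ∀ j < n, ‖G j - g j‖ ≤ K * ‖y j - z‖) (hK : (a * K * n) ^ 2 ≤ 1 / 8) :
    ‖y n - z + a • ∑ j ∈ Finset.range n, g j‖ ^ 2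
      ≤ 16 / 7 * (a ^ 4 * K ^ 2 * n)
        * ∑ i ∈ Finset.range n, ‖∑ j ∈ Finset.range i, g j‖ ^ 2 := by
  have hy : ∀ i ≤ n, y i - z + a • ∑ j ∈ Finset.range i, g j
      = -(a • ∑ j ∈ Finset.range i, (G j - g j)) := by
    intro i
    induction i with
    | zero => intro _; simp [h0]
    | succ k ih =>
      intro hk
      have hk' := ih (by omega)
      rw [Finset.sum_range_succ, Finset.sum_range_succ, hsucc k hk, smul_add, smul_add, neg_add,
        ← hk']
      module
  set S := ∑ i ∈ Finset.range n, ‖y i - z‖ ^ 2 with hS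
  set Q := ∑ i ∈ Finset.range n, ‖∑ j ∈ Finset.range i, g j‖ ^ 2
  have hS0 : 0 ≤ S := Finset.sum_nonneg fun _ _ => by positivity
  have herr : ∀ i ≤ n, ‖a • ∑ j ∈ Finset.range i, (G j - g j)‖ ^ 2
      ≤ a ^ 2 * K ^ 2 * S * i := by
    intro i hi
    rw [norm_smul, mul_pow, Real.norm_of_nonneg ha]
    have h1 := norm_sum_sq_le_card_mul (Finset.range i) fun j => G j - g j
    have h2 : ∑ j ∈ Finset.range i, ‖G j - g j‖ ^ 2 ≤ K ^ 2 * S := by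
      calc ∑ j ∈ Finset.range i, ‖G j - g j‖ ^ 2
          ≤ ∑ j ∈ Finset.range i, K ^ 2 * ‖y j - z‖ ^ 2 := by
            refine Finset.sum_le_sum fun j hj => ?_
            rw [← mul_pow]
            gcongr
            exact hG j ((Finset.mem_range.1 hj).trans_le hi)
        _ ≤ K ^ 2 * S := by
            rw [← Finset.mul_sum]
            gcongr
            exact Finset.sum_le_sum_of_subset_of_nonneg (Finset.range_mono hi)
              fun _ _ _ => by positivity
    rw [Finset.card_range] at h1
    calc a ^ 2 * ‖∑ j ∈ Finset.range i, (G j - g j)‖ ^ 2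
        ≤ a ^ 2 * (i * (K ^ 2 * S)) := by gcongr; exact h1.trans (by gcongr)
      _ = _ := by ring
  -- A self-bounding inequality: the drift `S` recurs on the right with factor `(a K n)² ≤ 1/8`.
  -- Absorbing it leaves `7/8 S ≤ 2 a² Q`, the origin of `16/7`.
  have hSle : S ≤ 2 * a ^ 2 * Q + 2 * (a ^ 2 * K ^ 2 * S) * ((n : ℝ) ^ 2 / 2) := by
    calc S ≤ ∑ i ∈ Finset.range n, (2 * a ^ 2 * ‖∑ j ∈ Finset.range i, g j‖ ^ 2
          + 2 * (a ^ 2 * K ^ 2 * S) * i) := by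
          refine Finset.sum_le_sum fun i hi => ?_
          have hi' := (Finset.mem_range.1 hi).le
          have e : y i - z = -(a • ∑ j ∈ Finset.range i, g j)
              + -(a • ∑ j ∈ Finset.range i, (G j - g j)) := by
            rw [← hy i hi']; abel
          rw [e]
          refine (norm_add_sq_le_two_mul _ _).trans ?_
          rw [norm_neg, norm_neg]
          have h1 := herr i hi'
          have h2 : ‖a • ∑ j ∈ Finset.range i, g j‖ ^ 2
              = a ^ 2 * ‖∑ j ∈ Finset.range i, g j‖ ^ 2 := by
            rw [norm_smul, mul_pow, Real.norm_of_nonneg ha]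
          rw [h2]
          linarith
      _ ≤ _ := by
          rw [Finset.sum_add_distrib, ← Finset.mul_sum, ← Finset.mul_sum]
          gcongr
          exact sum_range_cast_le n
  have hSle' : S ≤ 16 / 7 * a ^ 2 * Q := by
    have : (a * K * n) ^ 2 * S ≤ 1 / 8 * S := by gcongr
    linarith
  rw [hy n le_rfl, norm_neg]
  calc _ ≤ a ^ 2 * K ^ 2 * S * n := herr n le_rfl
    _ ≤ a ^ 2 * K ^ 2 * (16 / 7 * a ^ 2 * Q) * n := by gcongr
    _ = _ := by ring

end Sums

/-! ### The gradient variance along the iterates -/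

namespace CompositeProblem

lemma smul_gradient_avg (h : CompositeProblem L ρ f φ) {w} (hw : w ∈ dom φ) :
    (n : ℝ) • gradient (avg f) w = ∑ i, gradient (f i) w := by
  have hn : (n : ℝ) ≠ 0 := by exact_mod_cast h.n_pos.ne'
  rw [(hasGradientAt_avg fun i => (h.smooth i).diff w hw).gradient, smul_smul,
    mul_one_div_cancel hn, one_smul]

/-- The deviation at `w` is the deviation at `v` plus a centred gradient difference, and centring
does not increase the sum of squares. -/
lemma gradVariance_le_add (h : CompositeProblem L ρ f φ) {w v} (hw : w ∈ dom φ)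
    (hv : v ∈ dom φ) :
    gradVariance f w ≤ 2 * gradVariance f v + 2 * (L ^ 2 * ‖v - w‖ ^ 2) := by
  have hn : (0 : ℝ) < n := by exact_mod_cast h.n_pos
  have hmean : (n : ℝ) • (gradient (avg f) w - gradient (avg f) v)
      = ∑ i, (gradient (f i) w - gradient (f i) v) := by
    rw [smul_sub, h.smul_gradient_avg hw, h.smul_gradient_avg hv, Finset.sum_sub_distrib]
  have h1 := sum_norm_sub_mean_sq_le (fun i => gradient (f i) w - gradient (f i) v) hmean
  have h2 : ∑ i, ‖gradient (f i) w - gradient (f i) v‖ ^ 2 ≤ n * (L ^ 2 * ‖v - w‖ ^ 2) := by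
    calc ∑ i, ‖gradient (f i) w - gradient (f i) v‖ ^ 2
        ≤ ∑ _i : Fin n, L ^ 2 * ‖v - w‖ ^ 2 := by
          refine Finset.sum_le_sum fun i _ => ?_
          rw [← mul_pow, norm_sub_rev v w]
          gcongr
          exact (h.smooth i).lip w hw v hv
      _ = _ := by simp
  have h3 : ∑ j, ‖gradient (f j) w - gradient (avg f) w‖ ^ 2
      ≤ 2 * ∑ j, ‖gradient (f j) v - gradient (avg f) v‖ ^ 2 + 2 * (n * (L ^ 2 * ‖v - w‖ ^ 2)) := by
    calc ∑ j, ‖gradient (f j) w - gradient (avg f) w‖ ^ 2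
        ≤ ∑ j, (2 * ‖gradient (f j) v - gradient (avg f) v‖ ^ 2
          + 2 * ‖gradient (f j) w - gradient (f j) v
              - (gradient (avg f) w - gradient (avg f) v)‖ ^ 2) := by
          refine Finset.sum_le_sum fun j _ => ?_
          refine le_trans (le_of_eq ?_) (norm_add_sq_le_two_mul _ _)
          congr 2; abel
      _ ≤ _ := by
          rw [Finset.sum_add_distrib, ← Finset.mul_sum, ← Finset.mul_sum]
          linarith
  have h4 := mul_le_mul_of_nonneg_left h3 (by positivity : 0 ≤ 1 / (n : ℝ))
  rw [gradVariance, gradVariance]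
  refine h4.trans (le_of_eq ?_)
  field_simp

/-- Compares `w` with a solution `y` satisfying `c² ‖y - w‖² ≤ ψ(w) - p`. Such `y` exist for all `c²
< μ/2`, and the constant `4 L²/μ` is the limit `c² → μ/2`. -/
lemma gradVariance_le (h : CompositeProblem L ρ f φ) (hPL : PLCondition μ (objective f φ))
    (hp : optVal (objective f φ) = p) (hmin : ∀ w ∈ dom φ, p ≤ objReal f φ w) {s : ℝ}
    (hs : ∀ w ∈ dom φ, objReal f φ w = p → gradVariance f w ≤ s) {w} (hw : w ∈ dom φ) :
    gradVariance f w ≤ 2 * s + 4 * L ^ 2 / μ * (objReal f φ w - p) := by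
  have hμ := hPL.1
  have hr0 : 0 ≤ objReal f φ w - p := by linarith [hmin w hw]
  have key : ∀ c : ℝ, 0 < c → c ^ 2 < μ / 2 →
      (gradVariance f w - 2 * s) * c ^ 2 ≤ 2 * L ^ 2 * (objReal f φ w - p) := by
    intro c hc hcμ
    obtain ⟨y, hy, hyp, hdist⟩ := h.exists_optimal_near hPL hp hmin hc hcμ hw
    have h1 := h.gradVariance_le_add hw hy
    have h2 := hs y hy hyp
    have h3 : c ^ 2 * ‖y - w‖ ^ 2 ≤ objReal f φ w - p := by
      rw [← mul_pow, ← Real.sq_sqrt hr0]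
      gcongr
    have h4 : gradVariance f w - 2 * s ≤ 2 * (L ^ 2 * ‖y - w‖ ^ 2) := by linarith
    calc (gradVariance f w - 2 * s) * c ^ 2 ≤ 2 * (L ^ 2 * ‖y - w‖ ^ 2) * c ^ 2 := by gcongr
      _ = 2 * L ^ 2 * (c ^ 2 * ‖y - w‖ ^ 2) := by ring
      _ ≤ _ := by gcongr
  have hlim : (gradVariance f w - 2 * s) * (μ / 2) ≤ 2 * L ^ 2 * (objReal f φ w - p) := by
    rcases le_or_gt (gradVariance f w - 2 * s) 0 with hneg | hpos
    · exact (mul_nonpos_of_nonpos_of_nonneg hneg (by positivity)).trans (by positivity)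
    · rw [← le_div_iff₀' hpos]
      refine le_of_forall_lt_imp_le_of_dense fun κ hκ => ?_
      rcases le_or_gt κ 0 with hκ0 | hκ0
      · exact hκ0.trans (by positivity)
      · rw [le_div_iff₀' hpos]
        have := key (√κ) (Real.sqrt_pos.2 hκ0) (by rwa [Real.sq_sqrt hκ0.le])
        rwa [Real.sq_sqrt hκ0.le] at this
  have h5 : 4 * L ^ 2 / μ * (objReal f φ w - p)
      = 2 * L ^ 2 * (objReal f φ w - p) / (μ / 2) := by
    field_simp; ring
  have h6 : gradVariance f w - 2 * s ≤ 2 * L ^ 2 * (objReal f φ w - p) / (μ / 2) := by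
    rwa [le_div_iff₀ (by positivity)]
  linarith

end CompositeProblem

/-! ### Descent of the merit function along one epoch -/

/-- The conditions on the parameters of the method, with `C` and `τ` kept abstract. -/
structure StepParams (L ρ lam α τ C : ℝ) : Prop where
  lam_pos : 0 < lam
  rho_lt : 4 * lam * ρ < 1
  α_pos : 0 < α
  tau_pos : 0 < τ
  tau_le : τ ≤ 1 / 2
  tau_eq : τ * (2 * (1 - 2 * lam * ρ + lam ^ 2 * L ^ 2)) = 1 - 4 * lam * ρ
  alpha_lam : 128 * α ≤ lam
  alpha_L : 10 * L * α ≤ 1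
  alpha_C : 2 * C * α ^ 2 ≤ 1
  alpha_C_tau : 4 * C * lam * α ≤ τ
  lip_le : 4 * ((L + 2 * lam⁻¹ - ρ) / (1 - lam * ρ)) ^ 2 ≤ C

lemma stepParams_of_le_alphaBar {L ρ lam α : ℝ} (hL : 0 < L) (hρ : 0 ≤ ρ) (hlam : 0 < lam)
    (hlamρ : 4 * lam * ρ < 1) (hα : 0 < α) (hα₁ : α ≤ alphaBar L ρ lam) :
    StepParams L ρ lam α (constTau L ρ lam) (constC L ρ lam) := by
  set τ := constTau L ρ lam with hτ
  set C := constC L ρ lam with hC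
  have hlr : 0 ≤ lam * ρ := by positivity
  have hq : 0 < 2 * (1 - 2 * lam * ρ + lam ^ 2 * L ^ 2) := by
    have : 0 < lam ^ 2 * L ^ 2 := by positivity
    linarith
  have hτeq : τ * (2 * (1 - 2 * lam * ρ + lam ^ 2 * L ^ 2)) = 1 - 4 * lam * ρ := by
    rw [hτ, constTau, div_mul_cancel₀ _ hq.ne']
  have hτpos : 0 < τ := by rw [hτ, constTau]; exact div_pos (by linarith) hq
  have hτle : τ ≤ 1 / 2 := by
    rw [hτ, constTau, div_le_iff₀ hq]
    have : 0 < lam ^ 2 * L ^ 2 := by positivity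
    linarith
  have hden : 0 < 1 - lam * ρ := by linarith
  have hnum : 2 * lam⁻¹ * (1 - lam * ρ) ≤ L + 2 * lam⁻¹ - ρ := by
    have : lam⁻¹ * (lam * ρ) = ρ := by field_simp
    nlinarith
  have hbase : 2 * lam⁻¹ ≤ (L + 2 * lam⁻¹ - ρ) / (1 - lam * ρ) := by
    rwa [le_div_iff₀ hden]
  have hK : 0 < 2 * lam⁻¹ := by positivity
  have hlip : 4 * ((L + 2 * lam⁻¹ - ρ) / (1 - lam * ρ)) ^ 2 ≤ C := by
    rw [hC, constC]
    have : 0 ≤ (L + 2 * lam⁻¹ - ρ) / (1 - lam * ρ) := hK.le.trans hbase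
    gcongr
    linarith
  -- The resulting `C ≥ 16 λ⁻²`, with `4 C λ α ≤ τ ≤ 1/2`, gives `64 α/λ ≤ 1/2`, that is `128 α ≤
  -- λ`.
  have hC16 : 4 * (2 * lam⁻¹) ^ 2 ≤ C := le_trans (by gcongr) hlip
  have hCpos : 0 < C := lt_of_lt_of_le (by positivity) hC16
  have hm : ∀ m : ℝ, 0 < m → m ≤ max (√(2 * C)) (max (10 * L) (4 * C * lam / τ)) →
      m * α ≤ 1 := by
    intro m hm0 hm
    have h1 : α ≤ m⁻¹ := hα₁.trans (inv_anti₀ hm0 hm)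
    calc m * α ≤ m * m⁻¹ := by gcongr
      _ = 1 := mul_inv_cancel₀ hm0.ne'
  have h1 := hm _ (Real.sqrt_pos.2 (by linarith : 0 < 2 * C)) (le_max_left _ _)
  have h2 := hm (10 * L) (by linarith) ((le_max_left _ _).trans (le_max_right _ _))
  have h3 := hm (4 * C * lam / τ) (by positivity) ((le_max_right _ _).trans (le_max_right _ _))
  have hCτ : 4 * C * lam * α ≤ τ := by
    rw [div_mul_eq_mul_div, div_le_one hτpos] at h3
    exact h3
  refine ⟨hlam, hlamρ, hα, hτpos, hτle, hτeq, ?_, h2, ?_, hCτ, hlip⟩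
  · have h4 : 4 * (4 * (2 * lam⁻¹) ^ 2) * lam * α ≤ 4 * C * lam * α := by gcongr
    have h5 : 4 * (4 * (2 * lam⁻¹) ^ 2) * lam * α = 64 * α / lam := by field_simp; norm_num
    rw [h5] at h4
    have h6 : 64 * α / lam ≤ 1 / 2 := by linarith
    rw [div_le_iff₀ hlam] at h6
    linarith
  · calc 2 * C * α ^ 2 = (√(2 * C) * α) ^ 2 := by
          rw [mul_pow, Real.sq_sqrt (by linarith)]
      _ ≤ 1 ^ 2 := by gcongr
      _ = 1 := one_pow 2

/-- The real values of the merit function. -/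
noncomputable def meritReal (τ lam : ℝ) (f : Fin n → EuclideanSpace ℝ (Fin d) → ℝ)
    (φ : EuclideanSpace ℝ (Fin d) → EReal) (z : EuclideanSpace ℝ (Fin d)) : ℝ :=
  objReal f φ (prox lam φ z) + τ * lam / 2 * ‖normalMap lam f φ z‖ ^ 2

variable {α τ C : ℝ}

namespace StepParams

lemma lam_mul_rho_lt_one (hs : StepParams L ρ lam α τ C) (hρ : 0 ≤ ρ) : lam * ρ < 1 := by
  have := hs.rho_lt
  have : 0 ≤ lam * ρ := mul_nonneg hs.lam_pos.le hρ
  linarith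

/-- Young's inequality term by term. The `Φ²` coefficients `1/2 + 1/5 + 1/256` leave more than
`29/100` of the unit decrease, and the `E²` coefficients `25/69 + 5/8 + 1/512` stay below `1`. -/
lemma sq_norm_quadratic (hs : StepParams L ρ lam α τ C) (hρ : 0 ≤ ρ) {b Φ x E : ℝ}
    (hx : 0 ≤ x) (hE : 0 ≤ E) (hb : b = α / lam) :
    (1 - τ) * (E * x - (1 - b) * (1 - lam * ρ) * x ^ 2) - b * x ^ 2 + α * ((L + ρ) / 2) * x ^ 2
      + (-(τ * α ^ 2 * (1 - b / 2) * Φ ^ 2) + τ * α * (Φ * E) + τ * b / 2 * E ^ 2)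
      + (τ * α * lam * L * (Φ * x) + τ * α * L * (E * x)) + b * x ^ 2
      ≤ -(29 / 100 * τ * α ^ 2 * Φ ^ 2) + E ^ 2 := by
  have hlam := hs.lam_pos
  have hτ := hs.tau_pos
  have hα := hs.α_pos
  have hb0 : 0 < b := by rw [hb]; positivity
  have hb1 : b ≤ 1 / 128 := by
    rw [hb, div_le_iff₀ hlam]; linarith [hs.alpha_lam]
  have hr0 : 0 ≤ lam * ρ := by positivity
  have hr1 := hs.rho_lt
  have hαρ : α * ρ = b * (lam * ρ) := by rw [hb]; field_simp
  have y1 : τ * α * lam * L * (Φ * x) ≤ τ * α ^ 2 * Φ ^ 2 / 2 + τ * lam ^ 2 * L ^ 2 * x ^ 2 / 2 := by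
    have := mul_nonneg hτ.le (sq_nonneg (α * Φ - lam * L * x))
    nlinarith
  have y2 : τ * α * (Φ * E) ≤ 1 / 5 * (τ * α ^ 2 * Φ ^ 2) + 5 / 4 * (τ * E ^ 2) := by
    have := mul_nonneg hτ.le (sq_nonneg (2 / 5 * (α * Φ) - E))
    nlinarith
  -- The cross term may use exactly the negative `x²` supplied by `y6`; `25/69 = 1 / (4 · 69/100)`
  -- is the smallest admissible constant at `τ = 0`.
  have y3 : ((1 - τ) + τ * (α * L)) * (E * x) ≤ (69 / 100 - τ / 2) * x ^ 2 + 25 / 69 * E ^ 2 := by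
    set q := 69 / 100 - τ / 2 with hq
    set c := 1 - 9 / 10 * τ with hc
    have hτ2 := hs.tau_le
    have h1 : (1 - τ) + τ * (α * L) ≤ c := by nlinarith [hs.alpha_L]
    have h2 : ((1 - τ) + τ * (α * L)) * (E * x) ≤ c * (E * x) := by gcongr
    have hq0 : 0 < q := by linarith
    have h3 : c ^ 2 ≤ 4 * q * (25 / 69) := by nlinarith
    have h4 : 0 ≤ 4 * q * (q * x ^ 2 + 25 / 69 * E ^ 2 - c * (E * x)) := by
      nlinarith [sq_nonneg (2 * q * x - c * E), mul_le_mul_of_nonneg_right h3 (sq_nonneg E)]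
    have h5 := nonneg_of_mul_nonneg_right h4 (by linarith : 0 < 4 * q)
    linarith
  have y4 : b / 2 * (τ * α ^ 2 * Φ ^ 2) ≤ 1 / 256 * (τ * α ^ 2 * Φ ^ 2) := by
    refine mul_le_mul_of_nonneg_right ?_ (by positivity)
    linarith
  have y5 : 5 / 4 * (τ * E ^ 2) + τ * b / 2 * E ^ 2 ≤ (5 / 8 + 1 / 512) * E ^ 2 := by
    have : 5 / 4 * τ + τ * b / 2 ≤ 5 / 8 + 1 / 512 := by nlinarith [hs.tau_le]
    nlinarith [mul_le_mul_of_nonneg_right this (sq_nonneg E)]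
  have y6 : (-((1 - τ) * (1 - b) * (1 - lam * ρ)) + α * ((L + ρ) / 2)
      + τ * lam ^ 2 * L ^ 2 / 2) * x ^ 2 ≤ -(69 / 100 - τ / 2) * x ^ 2 := by
    refine mul_le_mul_of_nonneg_right ?_ (sq_nonneg x)
    -- The definition of `τ` makes this an identity.
    have h1 : (1 - τ) * (1 - lam * ρ) - τ * lam ^ 2 * L ^ 2 / 2 = 3 / 4 - τ / 2 := by
      linarith [hs.tau_eq]
    have h2 : b * ((1 - τ) * (1 - lam * ρ)) ≤ 1 / 128 * 1 := by
      have h3 : (1 - τ) * (1 - lam * ρ) ≤ 1 := by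
        nlinarith [hs.tau_le]
      have h4 : 0 ≤ (1 - τ) * (1 - lam * ρ) :=
        mul_nonneg (by linarith [hs.tau_le]) (by linarith)
      gcongr
    have h3 : b * (lam * ρ) ≤ 1 / 128 * (1 / 4) := by gcongr; linarith
    linarith [hs.alpha_L]
  have hEE := sq_nonneg E
  have hΦ : 0 ≤ τ * α ^ 2 * Φ ^ 2 := by positivity
  linarith

/-- Here `F` is the old normal map, `Z`, `D`, `g` are the changes of `z`, of its prox and of the
gradient, and `Z + α F` is the deviation from the exact step. Expanding the new normal map yields
`-τ⟪P, D⟫`, so `⟪P, D⟫` keeps the factor `1 - τ`; since `α P = e - (1 - b) Z`, cocoercivity turns it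
into a negative multiple of `‖D‖²`. -/
lemma sq_norm_vector_le {V : Type*} [NormedAddCommGroup V] [InnerProductSpace ℝ V]
    (hs : StepParams L ρ lam α τ C) (hL : 0 < L) (hρ : 0 ≤ ρ) (F Z D g : V)
    (hco : (1 - lam * ρ) * ‖D‖ ^ 2 ≤ inner ℝ Z D) (hlip : ‖g‖ ≤ L * ‖D‖) :
    α * (inner ℝ (F + lam⁻¹ • Z) D - lam⁻¹ * ‖D‖ ^ 2 + (L + ρ) / 2 * ‖D‖ ^ 2
      + τ * lam / 2 * (‖F + lam⁻¹ • Z + (g - lam⁻¹ • D)‖ ^ 2 - ‖F‖ ^ 2))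
      ≤ -(29 / 100 * τ * α ^ 2 * ‖F‖ ^ 2) + ‖Z + α • F‖ ^ 2 := by
  have hlam := hs.lam_pos
  have hα := hs.α_pos
  have hτ := hs.tau_pos
  obtain ⟨e, he⟩ : ∃ e, e = Z + α • F := ⟨_, rfl⟩
  obtain ⟨P, hP⟩ : ∃ P, P = F + lam⁻¹ • Z := ⟨_, rfl⟩
  obtain ⟨b, hb⟩ : ∃ b, b = α / lam := ⟨_, rfl⟩
  rw [← he, ← hP]
  have hb0 : 0 < b := by rw [hb]; positivity
  have hb1 : b ≤ 1 / 128 := by rw [hb, div_le_iff₀ hlam]; linarith [hs.alpha_lam]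
  have hPe : P = (1 - b) • F + lam⁻¹ • e := by
    rw [hP, he, hb, div_eq_inv_mul]; module
  have hαP : α • P = e - (1 - b) • Z := by
    rw [hP, he, hb, div_eq_mul_inv]; module
  have b1 : α * inner ℝ P D ≤ ‖e‖ * ‖D‖ - (1 - b) * (1 - lam * ρ) * ‖D‖ ^ 2 := by
    rw [← real_inner_smul_left, hαP, inner_sub_left, real_inner_smul_left]
    have h1 := real_inner_le_norm e D
    have h2 := mul_le_mul_of_nonneg_left hco (by linarith : 0 ≤ 1 - b)
    linarith
  -- This loss is cancelled by the term `-b ‖D‖²` from the descent of `ψ`.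
  have b2 : α * (τ * lam / 2 * ‖g - lam⁻¹ • D‖ ^ 2) ≤ b * ‖D‖ ^ 2 := by
    have h1 : ‖g - lam⁻¹ • D‖ ≤ (L + lam⁻¹) * ‖D‖ := by
      refine (norm_sub_le _ _).trans ?_
      rw [norm_smul, Real.norm_of_nonneg (inv_nonneg.2 hlam.le)]
      linarith
    have h2 : τ * (1 + lam * L) ^ 2 ≤ 2 := by
      have h3 : (1 + lam * L) ^ 2 ≤ 2 + 2 * (lam ^ 2 * L ^ 2) := by
        nlinarith [sq_nonneg (1 - lam * L)]
      have h4 : τ * (4 * lam * ρ) ≤ τ * 1 := by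
        gcongr; exact hs.rho_lt.le
      have h5 : 0 ≤ lam * ρ := by positivity
      nlinarith [hs.tau_eq, mul_le_mul_of_nonneg_left h3 hτ.le]
    calc α * (τ * lam / 2 * ‖g - lam⁻¹ • D‖ ^ 2)
        ≤ α * (τ * lam / 2 * ((L + lam⁻¹) * ‖D‖) ^ 2) := by gcongr
      _ = b / 2 * (τ * (1 + lam * L) ^ 2) * ‖D‖ ^ 2 := by rw [hb]; field_simp; ring
      _ ≤ b / 2 * 2 * ‖D‖ ^ 2 := by gcongr
      _ = _ := by ring
  have b3 : α * (τ * lam * inner ℝ P g)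
      ≤ τ * α * lam * L * (‖F‖ * ‖D‖) + τ * α * L * (‖e‖ * ‖D‖) := by
    have h1 : inner ℝ P g ≤ (‖F‖ + lam⁻¹ * ‖e‖) * (L * ‖D‖) := by
      refine (real_inner_le_norm _ _).trans ?_
      have : ‖P‖ ≤ ‖F‖ + lam⁻¹ * ‖e‖ := by
        rw [hPe]
        refine (norm_add_le _ _).trans ?_
        rw [norm_smul, norm_smul, Real.norm_of_nonneg (inv_nonneg.2 hlam.le),
          Real.norm_of_nonneg (by linarith : 0 ≤ 1 - b)]
        have : (1 - b) * ‖F‖ ≤ 1 * ‖F‖ := by gcongr; linarith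
        linarith
      gcongr
    calc α * (τ * lam * inner ℝ P g)
        ≤ α * (τ * lam * ((‖F‖ + lam⁻¹ * ‖e‖) * (L * ‖D‖))) := by gcongr
      _ = _ := by field_simp
  have b4 : α * (τ * lam / 2 * (‖P‖ ^ 2 - ‖F‖ ^ 2))
      ≤ -(τ * α ^ 2 * (1 - b / 2) * ‖F‖ ^ 2) + τ * α * (‖F‖ * ‖e‖) + τ * b / 2 * ‖e‖ ^ 2 := by
    have h1 : ‖P‖ ^ 2 = (1 - b) ^ 2 * ‖F‖ ^ 2 + 2 * ((1 - b) * (lam⁻¹ * inner ℝ F e))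
        + lam⁻¹ ^ 2 * ‖e‖ ^ 2 := by
      rw [hPe, norm_add_sq_real, norm_smul, norm_smul, real_inner_smul_left,
        real_inner_smul_right, mul_pow, mul_pow, Real.norm_eq_abs, Real.norm_eq_abs, sq_abs,
        sq_abs]
    have h2 : (1 - b) * inner ℝ F e ≤ 1 * (‖F‖ * ‖e‖) := by
      refine (mul_le_mul_of_nonneg_left (real_inner_le_norm F e) (by linarith)).trans ?_
      gcongr
      linarith
    have h3 : α * (τ * lam / 2 * (‖P‖ ^ 2 - ‖F‖ ^ 2)) = -(τ * α ^ 2 * (1 - b / 2) * ‖F‖ ^ 2)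
        + τ * α * ((1 - b) * inner ℝ F e) + τ * b / 2 * ‖e‖ ^ 2 := by
      rw [h1, hb]; field_simp; ring
    rw [h3]
    have h4 := mul_le_mul_of_nonneg_left h2 (by positivity : 0 ≤ τ * α)
    linarith
  have hF'sq : ‖P + (g - lam⁻¹ • D)‖ ^ 2 = ‖P‖ ^ 2 + 2 * inner ℝ P g
      - 2 * (lam⁻¹ * inner ℝ P D) + ‖g - lam⁻¹ • D‖ ^ 2 := by
    rw [norm_add_sq_real, inner_sub_right, real_inner_smul_right]; ring
  have hfin := hs.sq_norm_quadratic hρ (Φ := ‖F‖) (norm_nonneg D) (norm_nonneg e) hb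
  have b1' := mul_le_mul_of_nonneg_left b1 (by linarith [hs.tau_le] : 0 ≤ 1 - τ)
  have heq : α * (inner ℝ P D - lam⁻¹ * ‖D‖ ^ 2 + (L + ρ) / 2 * ‖D‖ ^ 2
      + τ * lam / 2 * (‖P + (g - lam⁻¹ • D)‖ ^ 2 - ‖F‖ ^ 2))
      = (1 - τ) * (α * inner ℝ P D) - b * ‖D‖ ^ 2 + α * ((L + ρ) / 2) * ‖D‖ ^ 2
      + α * (τ * lam / 2 * (‖P‖ ^ 2 - ‖F‖ ^ 2)) + α * (τ * lam * inner ℝ P g)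
      + α * (τ * lam / 2 * ‖g - lam⁻¹ • D‖ ^ 2) := by
    rw [hF'sq, hb]
    field_simp
    ring
  rw [heq]
  linarith

end StepParams

namespace CompositeProblem

lemma meritReal_le (h : CompositeProblem L ρ f φ) (hs : StepParams L ρ lam α τ C)
    (z z' : EuclideanSpace ℝ (Fin d)) :
    meritReal τ lam f φ z' ≤ meritReal τ lam f φ z
      - 29 / 100 * τ * α * ‖normalMap lam f φ z‖ ^ 2
      + ‖z' - z + α • normalMap lam f φ z‖ ^ 2 / α := by
  have hlam := hs.lam_pos
  have hlamρ := hs.lam_mul_rho_lt_one h.rho_nonneg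
  have hL := h.L_pos
  have hρ := h.rho_nonneg
  have hα := hs.α_pos
  have hτ := hs.tau_pos
  have hw := h.reg.prox_mem hlam hlamρ z
  have hw' := h.reg.prox_mem hlam hlamρ z'
  have hsub := h.reg.prox_subgradient hlam hlamρ z' hw
  have hco := h.reg.prox_cocoercive hlam hlamρ z z'
  have hf := h.smooth_avg.le_add h.convex_dom hw hw'
  have hlip := h.smooth_avg.lip _ hw' _ hw
  set w := prox lam φ z with hwdef
  set w' := prox lam φ z' with hwdef'
  set F := normalMap lam f φ z with hF
  set F' := normalMap lam f φ z' with hF'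
  set D := w' - w with hD
  set g := gradient (avg f) w' - gradient (avg f) w with hg
  set P := F + lam⁻¹ • (z' - z) with hP
  have hFP : F' = P + (g - lam⁻¹ • D) := by
    rw [hP, hF', hF, hg, hD, normalMap, normalMap, ← hwdef, ← hwdef']
    module
  -- Descent lemma for `f` at `w` combined with the prox inequality at `z'` tested at `w`.
  have hψ : objReal f φ w' ≤ objReal f φ w + inner ℝ P D - lam⁻¹ * ‖D‖ ^ 2
      + (L + ρ) / 2 * ‖D‖ ^ 2 := by
    have h1 : inner ℝ (z' - w') (w - w') = - inner ℝ (z' - w') D := by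
      rw [hD, ← neg_sub w' w, inner_neg_right]
    have h2 : inner ℝ P D = inner ℝ (gradient (avg f) w) D + lam⁻¹ * inner ℝ (z' - w') D
        + lam⁻¹ * ‖D‖ ^ 2 := by
      rw [← real_inner_self_eq_norm_sq, ← real_inner_smul_left, ← real_inner_smul_left,
        ← inner_add_left, ← inner_add_left, hP, hF, normalMap, ← hwdef, hD]
      congr 1; module
    rw [h1, norm_sub_rev w w'] at hsub
    rw [objReal, objReal]
    linarith
  have hmain : α * (meritReal τ lam f φ z' - meritReal τ lam f φ z)
      ≤ -(29 / 100 * τ * α ^ 2 * ‖F‖ ^ 2) + ‖z' - z + α • F‖ ^ 2 := by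
    refine le_trans ?_ (hs.sq_norm_vector_le hL hρ F (z' - z) D g hco hlip)
    rw [← hP, ← hFP]
    refine mul_le_mul_of_nonneg_left ?_ hα.le
    rw [meritReal, meritReal, ← hF, ← hF', ← hwdef, ← hwdef']
    linarith
  have h4 : meritReal τ lam f φ z' - meritReal τ lam f φ z
      ≤ (-(29 / 100 * τ * α ^ 2 * ‖F‖ ^ 2) + ‖z' - z + α • F‖ ^ 2) / α := by
    rwa [le_div_iff₀' hα]
  have h5 : (-(29 / 100 * τ * α ^ 2 * ‖F‖ ^ 2) + ‖z' - z + α • F‖ ^ 2) / α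
      = -(29 / 100 * τ * α * ‖F‖ ^ 2) + ‖z' - z + α • F‖ ^ 2 / α := by field_simp
  linarith

/-- The normal maps of the component functions are Lipschitz continuous. -/
lemma norm_component_sub_le (h : CompositeProblem L ρ f φ) (hlam : 0 < lam)
    (hlamρ : lam * ρ < 1) (i : Fin n) (z z' : EuclideanSpace ℝ (Fin d)) :
    ‖(gradient (f i) (prox lam φ z') + lam⁻¹ • (z' - prox lam φ z'))
      - (gradient (f i) (prox lam φ z) + lam⁻¹ • (z - prox lam φ z))‖
      ≤ (L + 2 * lam⁻¹ - ρ) / (1 - lam * ρ) * ‖z' - z‖ := by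
  have hL := h.L_pos
  have hden : 0 < 1 - lam * ρ := by linarith
  have h1 := h.reg.prox_lipschitz hlam hlamρ z z'
  have h2 := (h.smooth i).lip _ (h.reg.prox_mem hlam hlamρ z') _ (h.reg.prox_mem hlam hlamρ z)
  set w := prox lam φ z
  set w' := prox lam φ z'
  have h3 : ‖w' - w‖ ≤ ‖z' - z‖ / (1 - lam * ρ) := by rwa [le_div_iff₀' hden]
  calc _ = ‖(gradient (f i) w' - gradient (f i) w) + lam⁻¹ • (z' - z) - lam⁻¹ • (w' - w)‖ := by
        congr 1; module
    _ ≤ L * ‖w' - w‖ + lam⁻¹ * ‖z' - z‖ + lam⁻¹ * ‖w' - w‖ := by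
        refine (norm_sub_le _ _).trans (add_le_add ((norm_add_le _ _).trans ?_) ?_)
        · rw [norm_smul, Real.norm_of_nonneg (inv_nonneg.2 hlam.le)]; gcongr
        · rw [norm_smul, Real.norm_of_nonneg (inv_nonneg.2 hlam.le)]
    _ ≤ L * (‖z' - z‖ / (1 - lam * ρ)) + lam⁻¹ * ‖z' - z‖
        + lam⁻¹ * (‖z' - z‖ / (1 - lam * ρ)) := by gcongr
    _ = _ := by field_simp; ring

/-- The deviations of the component gradients from the full gradient at `prox z`. -/
noncomputable def gradDev (lam : ℝ) (f : Fin n → EuclideanSpace ℝ (Fin d) → ℝ)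
    (φ : EuclideanSpace ℝ (Fin d) → EReal) (z : EuclideanSpace ℝ (Fin d)) (i : Fin n) :
    EuclideanSpace ℝ (Fin d) :=
  gradient (f i) (prox lam φ z) - gradient (avg f) (prox lam φ z)

lemma sum_gradDev (h : CompositeProblem L ρ f φ) (hlam : 0 < lam)
    (hlamρ : lam * ρ < 1) (z : EuclideanSpace ℝ (Fin d)) : ∑ i, gradDev lam f φ z i = 0 := by
  simp only [gradDev]
  rw [Finset.sum_sub_distrib, ← h.smul_gradient_avg (h.reg.prox_mem hlam hlamρ z)]
  simp [← Nat.cast_smul_eq_nsmul ℝ]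

lemma sum_norm_gradDev_sq (h : CompositeProblem L ρ f φ) (z : EuclideanSpace ℝ (Fin d)) :
    ∑ i, ‖gradDev lam f φ z i‖ ^ 2 = n * gradVariance f (prox lam φ z) := by
  have hn : (n : ℝ) ≠ 0 := by exact_mod_cast h.n_pos.ne'
  simp only [gradDev, gradVariance]
  field_simp

lemma norm_sq_epoch_error_le (h : CompositeProblem L ρ f φ) (hs : StepParams L ρ lam α τ C)
    (σ : Equiv.Perm (Fin n)) (z : EuclideanSpace ℝ (Fin d)) :
    ‖innerIter lam f φ (α / n) σ z n - z + α • normalMap lam f φ z‖ ^ 2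
      ≤ C * α ^ 4 * ‖normalMap lam f φ z‖ ^ 2
        + 2 * C * α ^ 4 / n ^ 3 * partialSumsSq (gradDev lam f φ z ∘ σ) := by
  have hn : (0 : ℝ) < n := by exact_mod_cast h.n_pos
  have hlam := hs.lam_pos
  have hlamρ := hs.lam_mul_rho_lt_one h.rho_nonneg
  have hα := hs.α_pos
  set F := normalMap lam f φ z with hF
  set u := gradDev lam f φ z ∘ σ with hu
  set K := (L + 2 * lam⁻¹ - ρ) / (1 - lam * ρ)
  have hKC : 4 * K ^ 2 ≤ C := hs.lip_le
  set y := innerIter lam f φ (α / n) σ z with hy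
  set G : ℕ → EuclideanSpace ℝ (Fin d) := extendZero fun j : Fin n =>
    gradient (f (σ j)) (prox lam φ (y j)) + lam⁻¹ • (y j - prox lam φ (y j)) with hG
  set g : ℕ → EuclideanSpace ℝ (Fin d) := fun j => F + extendZero u j with hg
  have herr := norm_sq_incremental_error_le (y := y) (G := G) (g := g) (z := z) (a := α / n)
    (K := K) (n := n) (by positivity) rfl
    (by
      intro j hj
      rw [hG, extendZero_of_lt _ hj]
      simp only [hy, innerIter, dif_pos hj, innerStep])
    (by
      intro j hj
      have e : g j = gradient (f (σ ⟨j, hj⟩)) (prox lam φ z) + lam⁻¹ • (z - prox lam φ z) := by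
        simp only [hg]
        rw [extendZero_of_lt _ hj, hu, hF, normalMap, Function.comp_apply, gradDev]
        abel
      rw [hG, extendZero_of_lt _ hj, e]
      exact h.norm_component_sub_le hlam hlamρ _ _ _)
    (by
      rw [show α / n * K * n = α * K by field_simp, mul_pow]
      nlinarith [hs.alpha_C, mul_le_mul_of_nonneg_left hKC (sq_nonneg α)])
  have hsum : ∀ i : ℕ, ∑ j ∈ Finset.range i, g j
      = (i : ℝ) • F + ∑ j ∈ Finset.range i, extendZero u j := by
    intro i
    simp only [hg]
    rw [Finset.sum_add_distrib, Finset.sum_const, Finset.card_range, Nat.cast_smul_eq_nsmul]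
  -- Zero total deviation: the frozen epoch is the exact step `α F`.
  have hu0 : ∑ j ∈ Finset.range n, extendZero u j = 0 := by
    rw [sum_range_extendZero, hu]
    simp only [Function.comp_apply]
    rw [Equiv.sum_comp σ (gradDev lam f φ z), h.sum_gradDev hlam hlamρ]
  have hfull : (α / n) • ∑ j ∈ Finset.range n, g j = α • F := by
    rw [hsum, hu0, add_zero, smul_smul, div_mul_cancel₀ _ hn.ne']
  rw [hfull] at herr
  have hQ : ∑ i ∈ Finset.range n, ‖∑ j ∈ Finset.range i, g j‖ ^ 2
      ≤ 2 * ((n : ℝ) ^ 3 / 3 * ‖F‖ ^ 2) + 2 * partialSumsSq u := by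
    calc ∑ i ∈ Finset.range n, ‖∑ j ∈ Finset.range i, g j‖ ^ 2
        ≤ ∑ i ∈ Finset.range n, (2 * ((i : ℝ) ^ 2 * ‖F‖ ^ 2)
          + 2 * ‖∑ j ∈ Finset.range i, extendZero u j‖ ^ 2) := by
          refine Finset.sum_le_sum fun i _ => ?_
          rw [hsum]
          refine (norm_add_sq_le_two_mul _ _).trans (le_of_eq ?_)
          rw [norm_smul, mul_pow, Real.norm_of_nonneg (Nat.cast_nonneg i)]
      _ ≤ _ := by
          rw [Finset.sum_add_distrib, ← Finset.mul_sum, ← Finset.mul_sum, ← Finset.sum_mul,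
            partialSumsSq]
          gcongr
          exact sum_range_cast_sq_le n
  have hps : 0 ≤ partialSumsSq u := Finset.sum_nonneg fun _ _ => by positivity
  have hC : 0 ≤ C := le_trans (by positivity) hKC
  calc _ ≤ 16 / 7 * ((α / n) ^ 4 * K ^ 2 * n) *
        ∑ i ∈ Finset.range n, ‖∑ j ∈ Finset.range i, g j‖ ^ 2 := herr
    _ ≤ 16 / 7 * ((α / n) ^ 4 * (C / 4) * n) *
        (2 * ((n : ℝ) ^ 3 / 3 * ‖F‖ ^ 2) + 2 * partialSumsSq u) := by
        gcongr; linarith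
    _ = 8 / 21 * (C * α ^ 4 * ‖F‖ ^ 2) + 4 / 7 * (2 * C * α ^ 4 / n ^ 3 * partialSumsSq u) := by
        field_simp; ring
    _ ≤ 1 * (C * α ^ 4 * ‖F‖ ^ 2) + 1 * (2 * C * α ^ 4 / n ^ 3 * partialSumsSq u) := by
        gcongr <;> norm_num
    _ = _ := by ring

lemma meritReal_epoch_le (h : CompositeProblem L ρ f φ) (hs : StepParams L ρ lam α τ C)
    (σ : Equiv.Perm (Fin n)) (z : EuclideanSpace ℝ (Fin d)) :
    meritReal τ lam f φ (innerIter lam f φ (α / n) σ z n) ≤ meritReal τ lam f φ z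
      - τ * α / 4 * ‖normalMap lam f φ z‖ ^ 2
      + C * α ^ 3 / n ^ 3 * (2 * partialSumsSq (gradDev lam f φ z ∘ σ)) := by
  have hα := hs.α_pos
  have h1 := h.meritReal_le hs z (innerIter lam f φ (α / n) σ z n)
  have h2 := div_le_div_of_nonneg_right (h.norm_sq_epoch_error_le hs σ z) hα.le
  have h3 : (C * α ^ 4 * ‖normalMap lam f φ z‖ ^ 2
        + 2 * C * α ^ 4 / n ^ 3 * partialSumsSq (gradDev lam f φ z ∘ σ)) / α
      = C * α ^ 2 * α * ‖normalMap lam f φ z‖ ^ 2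
        + C * α ^ 3 / n ^ 3 * (2 * partialSumsSq (gradDev lam f φ z ∘ σ)) := by
    field_simp
  rw [h3] at h2
  -- From `4 C λ α ≤ τ` and `128 α ≤ λ`; the loss `1/512` is covered by the gap between `29/100` and
  -- `1/4`.
  have h4 : C * α ^ 2 ≤ τ / 512 := by
    have hC0 : 0 ≤ C := le_trans (by positivity) hs.lip_le
    have : 4 * (C * α) * (128 * α) ≤ 4 * (C * α) * lam := by
      gcongr; exact hs.alpha_lam
    nlinarith [hs.alpha_C_tau]
  have h5 : C * α ^ 2 * α * ‖normalMap lam f φ z‖ ^ 2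
      ≤ τ / 512 * α * ‖normalMap lam f φ z‖ ^ 2 := by gcongr
  have h6 : 0 ≤ τ * α * ‖normalMap lam f φ z‖ ^ 2 := by
    have := hs.tau_pos; positivity
  linarith

end CompositeProblem

/-! ### Linear recursions -/

lemma le_of_linear_recursion {x : ℕ → ℝ} {q B : ℝ} (hq : 0 ≤ q) (hq1 : q < 1) (hB : 0 ≤ B)
    (hx : ∀ k, x (k + 1) ≤ q * x k + B) (T : ℕ) : x T ≤ q ^ T * x 0 + B / (1 - q) := by
  have h1 : 0 < 1 - q := by linarith
  induction T with
  | zero =>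
    have : 0 ≤ B / (1 - q) := by positivity
    simpa using this
  | succ k ih =>
    have h2 : q * (B / (1 - q)) + B = B / (1 - q) := by field_simp; ring
    calc x (k + 1) ≤ q * x k + B := hx k
      _ ≤ q * (q ^ k * x 0 + B / (1 - q)) + B := by gcongr
      _ = q ^ (k + 1) * x 0 + (q * (B / (1 - q)) + B) := by ring
      _ = _ := by rw [h2]

/-! ### Random recursions driven by independent, identically distributed finite variables -/

lemma iterate_congr {S E : Type*} {step : S → E → E} {Z : (ℕ → S) → ℕ → E} {z : E}
    (h0 : ∀ π, Z π 0 = z) (hsucc : ∀ π k, Z π (k + 1) = step (π k) (Z π k)) {π π' : ℕ → S} (T : ℕ)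
    (h : ∀ k < T, π k = π' k) : Z π T = Z π' T := by
  induction T with
  | zero => rw [h0, h0]
  | succ k ih =>
    rw [hsucc, hsucc, ih fun j hj => h j (hj.trans k.lt_succ_self), h k k.lt_succ_self]

/-- The state after `T` steps is a function of `π 0, …, π (T - 1)`, hence independent of `π T`,
which can be averaged out. Histories form a finite discrete space, so `E` and `X` need no measurable
structure. -/
lemma lintegral_iterate_succ {Ω S E : Type*} [MeasurableSpace Ω] {P : Measure Ω} [Fintype S]
    [Nonempty S] [MeasurableSpace S] [DiscreteMeasurableSpace S] {π : ℕ → Ω → S}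
    (hm : ∀ k, Measurable (π k)) (hi : iIndepFun π P) {c : ENNReal}
    (hc : ∀ k s, P {ω | π k ω = s} = c) {step : S → E → E} {Z : (ℕ → S) → ℕ → E} {z : E}
    (h0 : ∀ π, Z π 0 = z) (hsucc : ∀ π k, Z π (k + 1) = step (π k) (Z π k)) (X : E → ENNReal)
    (T : ℕ) :
    ∫⁻ ω, X (Z (fun k => π k ω) (T + 1)) ∂P
      = ∫⁻ ω, ∑ s, c * X (step s (Z (fun k => π k ω) T)) ∂P := by
  classical
  obtain ⟨s₀⟩ := ‹Nonempty S›
  -- The entries from `T` on do not affect the state, so an arbitrary `s₀` fills them.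
  set G : (Finset.range T → S) → E := fun g =>
    Z (fun k => if h : k ∈ Finset.range T then g ⟨k, h⟩ else s₀) T with hG
  have hZ : ∀ ω, Z (fun k => π k ω) T = G fun i => π i ω := fun ω =>
    iterate_congr h0 hsucc T fun k hk => by simp [hk]
  have hind := hi.indepFun_finset (Finset.range T) {T} (by simp) hm
  have hmeasG : Measurable fun ω (i : Finset.range T) => π i ω :=
    measurable_pi_lambda _ fun i => hm i
  have hterm : ∀ s : S, ∫⁻ ω, {ω | π T ω = s}.indicator 1 ω * X (step s (G fun i => π i ω)) ∂P
      = c * ∫⁻ ω, X (step s (G fun i => π i ω)) ∂P := by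
    intro s
    have hA : Measurable fun g : ({T} : Finset ℕ) → S =>
        ({s} : Set S).indicator (1 : S → ENNReal) (g ⟨T, Finset.mem_singleton_self T⟩) :=
      (Measurable.of_discrete (f := ({s} : Set S).indicator (1 : S → ENNReal))).comp
        (measurable_pi_apply _)
    have hB : Measurable fun g : Finset.range T → S => X (step s (G g)) := Measurable.of_discrete
    have hAB := (hind.comp hB hA).symm
    have hmul := lintegral_mul_eq_lintegral_mul_lintegral_of_indepFun
      (hA.comp (measurable_pi_lambda _ fun i => hm i)) (hB.comp hmeasG) hAB
    have hset : MeasurableSet {ω | π T ω = s} := hm T (MeasurableSet.of_discrete (s := {s}))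
    have hone : ∫⁻ ω, {ω | π T ω = s}.indicator 1 ω ∂P = c := by
      rw [lintegral_indicator_one hset, hc]
    rw [← hone]
    exact hmul
  have hmeas : ∀ s : S, Measurable fun ω => X (step s (G fun i => π i ω)) := fun s =>
    (Measurable.of_discrete (f := fun g => X (step s (G g)))).comp hmeasG
  have hset : ∀ s : S, MeasurableSet {ω | π T ω = s} := fun s =>
    hm T (MeasurableSet.of_discrete (s := {s}))
  calc ∫⁻ ω, X (Z (fun k => π k ω) (T + 1)) ∂P
      = ∫⁻ ω, ∑ s, {ω | π T ω = s}.indicator 1 ω * X (step s (G fun i => π i ω)) ∂P := by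
        refine lintegral_congr fun ω => ?_
        rw [hsucc, hZ, Finset.sum_eq_single (π T ω)]
        · simp
        · intro s _ hs
          rw [Set.indicator_of_notMem (s := {ω | π T ω = s}) (fun h => hs h.symm), zero_mul]
        · simp
    _ = ∑ s, c * ∫⁻ ω, X (step s (G fun i => π i ω)) ∂P := by
        rw [lintegral_finsetSum]
        · exact Finset.sum_congr rfl fun s _ => hterm s
        · exact fun s _ => (measurable_one.indicator (hset s)).mul (hmeas s)
    _ = ∫⁻ ω, ∑ s, c * X (step s (Z (fun k => π k ω) T)) ∂P := by
        simp_rw [hZ]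
        rw [lintegral_finsetSum]
        · exact Finset.sum_congr rfl fun s _ => (lintegral_const_mul _ (hmeas s)).symm
        · exact fun s _ => (hmeas s).const_mul c

lemma lintegral_ofReal_iterate_le {Ω S E : Type*} [MeasurableSpace Ω] {P : Measure Ω}
    [IsProbabilityMeasure P] [Fintype S] [Nonempty S] [MeasurableSpace S]
    [DiscreteMeasurableSpace S] {π : ℕ → Ω → S} (hm : ∀ k, Measurable (π k))
    (hi : iIndepFun π P) {c : ℝ} (hc0 : 0 ≤ c) (hc : ∀ k s, P {ω | π k ω = s} = ENNReal.ofReal c)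
    {step : S → E → E} {Z : (ℕ → S) → ℕ → E} {z : E} (h0 : ∀ π, Z π 0 = z)
    (hsucc : ∀ π k, Z π (k + 1) = step (π k) (Z π k)) {Y : E → ℝ} (hY : ∀ z, 0 ≤ Y z) {q B : ℝ}
    (hq : 0 ≤ q) (hq1 : q < 1) (hB : 0 ≤ B) (hstep : ∀ z, c * ∑ s, Y (step s z) ≤ q * Y z + B)
    (T : ℕ) :
    ∫⁻ ω, ENNReal.ofReal (Y (Z (fun k => π k ω) T)) ∂P
      ≤ ENNReal.ofReal (q ^ T * Y z + B / (1 - q)) := by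
  have h1 : 0 < 1 - q := by linarith
  have hBq : 0 ≤ B / (1 - q) := by positivity
  induction T with
  | zero =>
    simp only [h0, lintegral_const, measure_univ, mul_one, pow_zero, one_mul]
    exact ENNReal.ofReal_le_ofReal (by linarith)
  | succ k ih =>
    rw [lintegral_iterate_succ hm hi hc h0 hsucc fun z => ENNReal.ofReal (Y z)]
    calc ∫⁻ ω, ∑ s, ENNReal.ofReal c * ENNReal.ofReal (Y (step s (Z (fun k => π k ω) k))) ∂P
        ≤ ∫⁻ ω, (ENNReal.ofReal q * ENNReal.ofReal (Y (Z (fun k => π k ω) k))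
          + ENNReal.ofReal B) ∂P := by
          refine lintegral_mono fun ω => ?_
          rw [← Finset.mul_sum, ← ENNReal.ofReal_sum_of_nonneg fun s _ => hY _,
            ← ENNReal.ofReal_mul hc0, ← ENNReal.ofReal_mul hq,
            ← ENNReal.ofReal_add (mul_nonneg hq (hY _)) hB]
          exact ENNReal.ofReal_le_ofReal (hstep _)
      _ = ENNReal.ofReal q * ∫⁻ ω, ENNReal.ofReal (Y (Z (fun k => π k ω) k)) ∂P
          + ENNReal.ofReal B := by
          rw [lintegral_add_right _ measurable_const, lintegral_const_mul' _ _ ENNReal.ofReal_ne_top,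
            lintegral_const, measure_univ, mul_one]
      _ ≤ ENNReal.ofReal q * ENNReal.ofReal (q ^ k * Y z + B / (1 - q)) + ENNReal.ofReal B := by
          gcongr
      _ = ENNReal.ofReal (q ^ (k + 1) * Y z + B / (1 - q)) := by
          have hYz := hY z
          rw [← ENNReal.ofReal_mul hq, ← ENNReal.ofReal_add (by positivity) hB]
          congr 1
          field_simp
          ring

/-! ### The contraction of the merit function and the main result -/

namespace CompositeProblem

lemma le_meritReal (h : CompositeProblem L ρ f φ) (hlam : 0 < lam) (hlamρ : lam * ρ < 1)
    (hτ : 0 ≤ τ) (hPL : PLCondition μ (objective f φ)) (hp : optVal (objective f φ) = p)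
    (z : EuclideanSpace ℝ (Fin d)) :
    (1 + μ * τ * lam) * (objReal f φ (prox lam φ z) - p) ≤ meritReal τ lam f φ z - p := by
  have h1 := mul_le_mul_of_nonneg_left (h.le_norm_normalMap_sq hlam hlamρ hPL hp z)
    (by positivity : 0 ≤ τ * lam / 2)
  rw [meritReal]
  linarith

/-- The decrease `τα/4 ‖F‖²` is split as `1/4 = 1/6 + 1/12`: by PL the first part yields the
contraction, the second the reserve `αμτ/6 (ψ - p)` that will absorb the growth of the variance. -/
lemma meritReal_sub_epoch_le (h : CompositeProblem L ρ f φ) (hs : StepParams L ρ lam α τ C)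
    (hPL : PLCondition μ (objective f φ)) (hp : optVal (objective f φ) = p)
    (σ : Equiv.Perm (Fin n)) (z : EuclideanSpace ℝ (Fin d)) :
    meritReal τ lam f φ (innerIter lam f φ (α / n) σ z n) - p
      ≤ (1 - μ * τ / (3 * (1 + μ * τ * lam)) * α) * (meritReal τ lam f φ z - p)
        - α * μ * τ / 6 * (objReal f φ (prox lam φ z) - p)
        + C * α ^ 3 / n ^ 3 * (2 * partialSumsSq (gradDev lam f φ z ∘ σ)) := by
  have hlam := hs.lam_pos
  have hα := hs.α_pos
  have hτ := hs.tau_pos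
  have hμ := hPL.1
  have h1 := h.meritReal_epoch_le hs σ z
  have h2 := h.le_norm_normalMap_sq hlam (hs.lam_mul_rho_lt_one h.rho_nonneg) hPL hp z
  set Δ := objReal f φ (prox lam φ z) - p with hΔ
  set Φ := ‖normalMap lam f φ z‖ ^ 2 with hΦ
  have hH : meritReal τ lam f φ z - p = Δ + τ * lam / 2 * Φ := by rw [meritReal]; ring
  have h3 : μ * τ / (3 * (1 + μ * τ * lam)) * α * (Δ + τ * lam / 2 * Φ) ≤ τ * α / 6 * Φ := by
    have h4 : Δ + τ * lam / 2 * Φ ≤ (1 + μ * τ * lam) / (2 * μ) * Φ := by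
      have : Δ ≤ Φ / (2 * μ) := by rwa [le_div_iff₀' (by positivity)]
      have e : (1 + μ * τ * lam) / (2 * μ) * Φ = Φ / (2 * μ) + τ * lam / 2 * Φ := by field_simp
      linarith
    calc μ * τ / (3 * (1 + μ * τ * lam)) * α * (Δ + τ * lam / 2 * Φ)
        ≤ μ * τ / (3 * (1 + μ * τ * lam)) * α * ((1 + μ * τ * lam) / (2 * μ) * Φ) := by gcongr
      _ = _ := by field_simp; ring
  have h5 := mul_le_mul_of_nonneg_left h2 (by positivity : 0 ≤ τ * α / 12)
  generalize μ * τ / (3 * (1 + μ * τ * lam)) = ν at h3 ⊢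
  rw [hH]
  linarith

/-- The step size condition, squared, is `24 C L² α² ≤ μ² τ`, exactly what the reserve needs to
absorb the term `4 L²/μ (ψ - p)` of `gradVariance_le`. -/
lemma variance_term_le (h : CompositeProblem L ρ f φ) (hs : StepParams L ρ lam α τ C)
    (hPL : PLCondition μ (objective f φ)) (hp : optVal (objective f φ) = p)
    (hmin : ∀ w ∈ dom φ, p ≤ objReal f φ w) {s : ℝ}
    (hvar : ∀ w ∈ dom φ, objReal f φ w = p → gradVariance f w ≤ s)
    (hα₃ : α ≤ μ * √τ / (2 * L * √(6 * C))) (z : EuclideanSpace ℝ (Fin d)) :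
    C * α ^ 3 * gradVariance f (prox lam φ z)
      ≤ 2 * C * α ^ 3 * s + α * μ * τ / 6 * (objReal f φ (prox lam φ z) - p) := by
  have hlam := hs.lam_pos
  have hα := hs.α_pos
  have hτ := hs.tau_pos
  have hμ := hPL.1
  have hL := h.L_pos
  have hw := h.reg.prox_mem hlam (hs.lam_mul_rho_lt_one h.rho_nonneg) z
  have hC0 : 0 ≤ C := le_trans (by positivity) hs.lip_le
  have hC : 0 < C := by
    rcases hC0.eq_or_lt with h0 | h0
    -- For `C = 0` the bound on `α` is a division by zero, hence `0`, contradicting `α > 0`.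
    · rw [← h0] at hα₃; simp at hα₃; linarith
    · exact h0
  have h1 := mul_le_mul_of_nonneg_left (h.gradVariance_le hPL hp hmin hvar hw)
    (by positivity : 0 ≤ C * α ^ 3)
  have hsq : (α * (2 * L * √(6 * C))) ^ 2 ≤ (μ * √τ) ^ 2 := by
    rw [le_div_iff₀ (by positivity)] at hα₃
    gcongr
  rw [mul_pow, mul_pow, mul_pow, mul_pow, Real.sq_sqrt hτ.le, Real.sq_sqrt (by positivity)] at hsq
  have h2 : C * α ^ 3 * (4 * L ^ 2 / μ) ≤ α * μ * τ / 6 := by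
    rw [← mul_div_assoc, div_le_iff₀ hμ]
    nlinarith
  have h3 : 0 ≤ objReal f φ (prox lam φ z) - p := by linarith [hmin _ hw]
  nlinarith [mul_le_mul_of_nonneg_right h2 h3]

lemma meritReal_contraction (h : CompositeProblem L ρ f φ) (hs : StepParams L ρ lam α τ C)
    (hPL : PLCondition μ (objective f φ)) (hp : optVal (objective f φ) = p)
    (hmin : ∀ w ∈ dom φ, p ≤ objReal f φ w) {s : ℝ}
    (hvar : ∀ w ∈ dom φ, objReal f φ w = p → gradVariance f w ≤ s)
    (hα₃ : α ≤ μ * √τ / (2 * L * √(6 * C))) (σ : Equiv.Perm (Fin n))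
    (z : EuclideanSpace ℝ (Fin d)) :
    meritReal τ lam f φ (innerIter lam f φ (α / n) σ z n) - p
      ≤ (1 - μ * τ / (3 * (1 + μ * τ * lam)) * α) * (meritReal τ lam f φ z - p)
        + 2 * C * α ^ 3 * s := by
  have hn : (0 : ℝ) < n := by exact_mod_cast h.n_pos
  have hC : 0 ≤ C := le_trans (by positivity) hs.lip_le
  have hα := hs.α_pos
  have h1 := h.meritReal_sub_epoch_le hs hPL hp σ z
  have h2 := h.variance_term_le hs hPL hp hmin hvar hα₃ z
  have h3 := partialSumsSq_perm_le (gradDev lam f φ z) σ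
  rw [h.sum_norm_gradDev_sq] at h3
  have h4 := mul_le_mul_of_nonneg_left h3 (by positivity : 0 ≤ C * α ^ 3 / n ^ 3)
  have h5 : C * α ^ 3 / n ^ 3 * ((n : ℝ) ^ 2 * (n * gradVariance f (prox lam φ z)))
      = C * α ^ 3 * gradVariance f (prox lam φ z) := by field_simp
  linarith

lemma meritReal_contraction_average (h : CompositeProblem L ρ f φ)
    (hs : StepParams L ρ lam α τ C)
    (hPL : PLCondition μ (objective f φ)) (hp : optVal (objective f φ) = p)
    (hmin : ∀ w ∈ dom φ, p ≤ objReal f φ w) {s : ℝ}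
    (hvar : ∀ w ∈ dom φ, objReal f φ w = p → gradVariance f w ≤ s)
    (hα₃ : α ≤ μ * √τ / (2 * L * √(6 * C))) (z : EuclideanSpace ℝ (Fin d)) :
    (n.factorial : ℝ)⁻¹ * ∑ σ : Equiv.Perm (Fin n),
        (meritReal τ lam f φ (innerIter lam f φ (α / n) σ z n) - p)
      ≤ (1 - μ * τ / (3 * (1 + μ * τ * lam)) * α) * (meritReal τ lam f φ z - p)
        + 2 * C * α ^ 3 * s / n := by
  have hn : (0 : ℝ) < n := by exact_mod_cast h.n_pos
  have hn1 : (1 : ℝ) ≤ n := by exact_mod_cast h.n_pos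
  have hfac : (0 : ℝ) < n.factorial := by exact_mod_cast n.factorial_pos
  have hC : 0 ≤ C := le_trans (by positivity) hs.lip_le
  have hα := hs.α_pos
  have hτ := hs.tau_pos
  have hμ := hPL.1
  have hlamρ := hs.lam_mul_rho_lt_one h.rho_nonneg
  have hΔ : 0 ≤ objReal f φ (prox lam φ z) - p := by
    linarith [hmin _ (h.reg.prox_mem hs.lam_pos hlamρ z)]
  have h1 := Finset.sum_le_sum fun (σ : Equiv.Perm (Fin n)) (_ : σ ∈ Finset.univ) =>
    h.meritReal_sub_epoch_le hs hPL hp σ z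
  rw [Finset.sum_add_distrib, Finset.sum_const, ← Finset.mul_sum, ← Finset.mul_sum,
    Finset.card_univ, Fintype.card_perm, Fintype.card_fin, nsmul_eq_mul] at h1
  have h2 := div_le_div_of_nonneg_right (h.variance_term_le hs hPL hp hmin hvar hα₃ z) hn.le
  have h3 := sum_perm_partialSumsSq_le (h.sum_gradDev hs.lam_pos hlamρ z)
  rw [h.sum_norm_gradDev_sq] at h3
  have h4 := mul_le_mul_of_nonneg_left h3 (by positivity : 0 ≤ C * α ^ 3 / n ^ 3)
  have h5 : C * α ^ 3 / n ^ 3 * (n.factorial * (n * (n * gradVariance f (prox lam φ z))))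
      = n.factorial * (C * α ^ 3 * gradVariance f (prox lam φ z) / n) := by field_simp
  -- Averaging divides the variance term by `n` but not the reserve, so the reserve still suffices.
  have h6 : α * μ * τ / 6 * (objReal f φ (prox lam φ z) - p) / n
      ≤ α * μ * τ / 6 * (objReal f φ (prox lam φ z) - p) :=
    div_le_self (by positivity) hn1
  rw [add_div] at h2
  have h7 := mul_le_mul_of_nonneg_left (h2.trans (add_le_add le_rfl h6)) hfac.le
  rw [inv_mul_le_iff₀ hfac]
  linarith

end CompositeProblem

/-- The final bound in terms of real numbers. -/
lemma final_bound {x Δ x₀ s μ τ lam C α ν m : ℝ} {T : ℕ} (hμ : 0 < μ) (hτ : 0 < τ)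
    (hlam : 0 < lam) (hα : 0 < α) (hm : 0 < m) (hx₀ : 0 ≤ x₀)
    (hν : ν = μ * τ / (3 * (1 + μ * τ * lam))) (hνα : ν * α ≤ 1)
    (hΔ : (1 + μ * τ * lam) * Δ ≤ x)
    (hx : x ≤ (1 - ν * α) ^ T * x₀ + 2 * C * α ^ 3 * s / m / (1 - (1 - ν * α))) :
    Δ ≤ Real.exp (-(T * ν * α)) / (1 + μ * τ * lam) * x₀
      + 6 * C * α ^ 2 / (m * μ * τ) * s := by
  have hA : 0 < 1 + μ * τ * lam := by positivity
  have hexp : (1 - ν * α) ^ T ≤ Real.exp (-(T * ν * α)) := by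
    calc (1 - ν * α) ^ T ≤ Real.exp (-(ν * α)) ^ T := by
          have h0 : 0 ≤ 1 - ν * α := by linarith
          exact pow_le_pow_left₀ h0 (Real.one_sub_le_exp_neg _) T
      _ = _ := by rw [← Real.exp_nat_mul]; congr 1; ring
  -- The geometric series contributes `1/(να)`; the factor `1 + μτλ` in `1/ν` cancels in the passage
  -- from merit to objective gap.
  have h1 : 2 * C * α ^ 3 * s / m / (1 - (1 - ν * α))
      = (1 + μ * τ * lam) * (6 * C * α ^ 2 / (m * μ * τ) * s) := by
    rw [sub_sub_cancel, hν]; field_simp; ring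
  have h2 : Real.exp (-(T * ν * α)) * x₀
      = (1 + μ * τ * lam) * (Real.exp (-(T * ν * α)) / (1 + μ * τ * lam) * x₀) := by
    field_simp
  have h3 := mul_le_mul_of_nonneg_right hexp hx₀
  refine le_of_mul_le_mul_left ?_ hA
  rw [mul_add, ← h1, ← h2]
  linarith

end NormPRR

theorem theorem14 (d n : ℕ) (hn : 0 < n)
    (f : Fin n → EuclideanSpace ℝ (Fin d) → ℝ) (φ : EuclideanSpace ℝ (Fin d) → EReal)
    (L ρ lam μ α : ℝ)
    -- the component functions are differentiable with `L`-Lipschitz gradients on `dom φ`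
    (hL : 0 < L)
    (hdiff : ∀ i, ∀ w ∈ NormPRR.dom φ, DifferentiableAt ℝ (f i) w)
    (hlip : ∀ i, ∀ w ∈ NormPRR.dom φ, ∀ v ∈ NormPRR.dom φ,
      ‖gradient (f i) w - gradient (f i) v‖ ≤ L * ‖w - v‖)
    -- `φ` is proper, lower semicontinuous and `ρ`-weakly convex
    (hρ : 0 ≤ ρ) (hproper : NormPRR.Proper φ) (hlsc : LowerSemicontinuous φ)
    (hweak : NormPRR.WeaklyConvex ρ φ)
    -- PL condition and existence of optimal solutions
    (hPL : NormPRR.PLCondition μ (NormPRR.objective f φ))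
    (hW : (NormPRR.optSet (NormPRR.objective f φ)).Nonempty)
    -- `λ ∈ (0, 1/(4ρ))` and the step size condition
    (hlam : 0 < lam) (hlamρ : 4 * lam * ρ < 1)
    (hα : 0 < α) (hα₁ : α ≤ NormPRR.alphaBar L ρ lam)
    (hα₂ : α ≤ (NormPRR.constNu L ρ lam μ)⁻¹)
    (hα₃ : α ≤ μ * Real.sqrt (NormPRR.constTau L ρ lam) /
      (2 * L * Real.sqrt (6 * NormPRR.constC L ρ lam)))
    (z₁ : EuclideanSpace ℝ (Fin d)) :
    -- (a) every sequence of permutations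
    (∀ (π : ℕ → Equiv.Perm (Fin n)) (T : ℕ), 1 ≤ T →
      NormPRR.objective f φ (NormPRR.wIter lam f φ (fun _ => α / n) π z₁ T)
          - NormPRR.optVal (NormPRR.objective f φ) ≤
        NormPRR.linearTerm L ρ lam μ α f φ z₁ T +
          ((6 * NormPRR.constC L ρ lam * α ^ 2 / (μ * NormPRR.constTau L ρ lam) : ℝ) : EReal) *
            NormPRR.sigmaStarSq f φ) ∧
    -- (b) uniform reshuffling, in expectation
    (∀ (Ω : Type*) [MeasurableSpace Ω] (P : Measure Ω) [IsProbabilityMeasure P]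
      (π : ℕ → Ω → Equiv.Perm (Fin n)), NormPRR.UniformReshuffling P π → ∀ T : ℕ, 1 ≤ T →
      ((∫⁻ ω, (NormPRR.objective f φ
            (NormPRR.wIter lam f φ (fun _ => α / n) (fun k => π k ω) z₁ T)
          - NormPRR.optVal (NormPRR.objective f φ)).toENNReal ∂P : ENNReal) : EReal) ≤
        NormPRR.linearTerm L ρ lam μ α f φ z₁ T +
          ((6 * NormPRR.constC L ρ lam * α ^ 2 / (n * μ * NormPRR.constTau L ρ lam) : ℝ) :
            EReal) * NormPRR.sigmaStarSq f φ) ∧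
    -- linear convergence in the interpolation case
    (NormPRR.sigmaStarSq f φ = 0 → ∀ (π : ℕ → Equiv.Perm (Fin n)) (T : ℕ), 1 ≤ T →
      NormPRR.objective f φ (NormPRR.wIter lam f φ (fun _ => α / n) π z₁ T)
          - NormPRR.optVal (NormPRR.objective f φ) ≤
        NormPRR.linearTerm L ρ lam μ α f φ z₁ T) := by
  have hs := NormPRR.stepParams_of_le_alphaBar hL hρ hlam hlamρ hα hα₁
  have h : NormPRR.CompositeProblem L ρ f φ :=
    ⟨hn, hL, hρ, fun i => ⟨hdiff i, hlip i⟩, ⟨hproper, hlsc, hweak⟩⟩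
  have hlamρ' := hs.lam_mul_rho_lt_one hρ
  have hμ := hPL.1
  have hτ := hs.tau_pos
  have hC : 0 ≤ NormPRR.constC L ρ lam := le_trans (by positivity) hs.lip_le
  have hn' : (0 : ℝ) < n := by exact_mod_cast hn
  obtain ⟨p, hp, hmin, hopt⟩ := h.exists_optVal_eq hW
  have hνpos : 0 < NormPRR.constNu L ρ lam μ := by rw [NormPRR.constNu]; positivity
  have hνα : NormPRR.constNu L ρ lam μ * α ≤ 1 := by
    calc NormPRR.constNu L ρ lam μ * α
        ≤ NormPRR.constNu L ρ lam μ * (NormPRR.constNu L ρ lam μ)⁻¹ := by gcongr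
      _ = 1 := mul_inv_cancel₀ hνpos.ne'
  have hνα0 : 0 < NormPRR.constNu L ρ lam μ * α := mul_pos hνpos hα
  have hνdef : NormPRR.constNu L ρ lam μ = μ * NormPRR.constTau L ρ lam
      / (3 * (1 + μ * NormPRR.constTau L ρ lam * lam)) := rfl
  have hlin : ∀ T, NormPRR.linearTerm L ρ lam μ α f φ z₁ T
      = ((Real.exp (-(T * NormPRR.constNu L ρ lam μ * α))
          / (1 + μ * NormPRR.constTau L ρ lam * lam)
        * (NormPRR.meritReal (NormPRR.constTau L ρ lam) lam f φ z₁ - p) : ℝ) : EReal) := by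
    intro T
    rw [NormPRR.linearTerm, NormPRR.merit, hp, h.objective_eq (h.reg.prox_mem hlam hlamρ' z₁),
      ← EReal.coe_add, ← EReal.coe_sub, ← EReal.coe_mul, NormPRR.meritReal]
  set τ := NormPRR.constTau L ρ lam
  set C := NormPRR.constC L ρ lam
  set ν := NormPRR.constNu L ρ lam μ
  have hA : 0 < 1 + μ * τ * lam := by positivity
  have hgap : ∀ z, NormPRR.objective f φ (NormPRR.prox lam φ z)
      - NormPRR.optVal (NormPRR.objective f φ)
      = ((NormPRR.objReal f φ (NormPRR.prox lam φ z) - p : ℝ) : EReal) := fun z => by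
    rw [hp, h.objective_eq (h.reg.prox_mem hlam hlamρ' z), ← EReal.coe_sub]
  have hgap0 : ∀ z, 0 ≤ NormPRR.objReal f φ (NormPRR.prox lam φ z) - p := fun z => by
    linarith [hmin _ (h.reg.prox_mem hlam hlamρ' z)]
  have hmerit := h.le_meritReal hlam hlamρ' hτ.le hPL hp
  have hmerit0 : ∀ z, 0 ≤ NormPRR.meritReal τ lam f φ z - p := fun z =>
    (mul_nonneg hA.le (hgap0 z)).trans (hmerit z)
  -- the value of `σ_*²` is a nonnegative real number or infinite
  have hσ0 : 0 ≤ NormPRR.sigmaStarSq f φ := by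
    obtain ⟨w, hw⟩ := hW
    refine le_trans ?_ (le_iSup₂ (f := fun w _ => (NormPRR.gradVariance f w : EReal)) w hw)
    rw [EReal.coe_nonneg, NormPRR.gradVariance]
    positivity
  have hσ : NormPRR.sigmaStarSq f φ = ⊤ ∨ ∃ s : ℝ, 0 ≤ s ∧ NormPRR.sigmaStarSq f φ = s ∧
      ∀ w ∈ NormPRR.dom φ, NormPRR.objReal f φ w = p → NormPRR.gradVariance f w ≤ s := by
    refine or_iff_not_imp_left.2 fun htop => ?_
    have hcoe := EReal.coe_toReal htop (ne_bot_of_le_ne_bot (by simp) hσ0)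
    refine ⟨_, EReal.toReal_nonneg hσ0, hcoe.symm, fun w hw hwp => ?_⟩
    rw [← EReal.coe_le_coe_iff, hcoe]
    exact le_iSup₂ (f := fun w _ => (NormPRR.gradVariance f w : EReal)) w (hopt w hw hwp)
  have hinf : ∀ (T : ℕ) (c : ℝ), 0 < c → ∀ x : EReal, NormPRR.sigmaStarSq f φ = ⊤ →
      x ≤ NormPRR.linearTerm L ρ lam μ α f φ z₁ T + (c : EReal) * NormPRR.sigmaStarSq f φ := by
    intro T c hc x htop
    rw [htop, EReal.coe_mul_top_of_pos hc, hlin, EReal.coe_add_top]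
    exact le_top
  have hCpos : 0 < C := by
    rcases hC.eq_or_lt with h0 | h0
    · rw [← h0] at hα₃; simp at hα₃; linarith
    · exact h0
  have hdet : ∀ (π : ℕ → Equiv.Perm (Fin n)) (T : ℕ), 1 ≤ T →
      NormPRR.objective f φ (NormPRR.wIter lam f φ (fun _ => α / n) π z₁ T)
          - NormPRR.optVal (NormPRR.objective f φ) ≤
        NormPRR.linearTerm L ρ lam μ α f φ z₁ T +
          ((6 * C * α ^ 2 / (μ * τ) : ℝ) : EReal) * NormPRR.sigmaStarSq f φ := by
    intro π T _
    -- An infinite `σ_*²` has a positive coefficient, so the right side is `⊤`.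
    rcases hσ with htop | ⟨s, hs0, hseq, hvar⟩
    · exact hinf T _ (by positivity) _ htop
    rw [NormPRR.wIter, hgap, hseq, hlin, ← EReal.coe_mul, ← EReal.coe_add, EReal.coe_le_coe_iff]
    have hrec := NormPRR.le_of_linear_recursion
      (x := fun k => NormPRR.meritReal τ lam f φ (NormPRR.zIter lam f φ (fun _ => α / n) π z₁ k) - p)
      (q := 1 - ν * α) (B := 2 * C * α ^ 3 * s) (by linarith) (by linarith) (by positivity)
      (fun k => h.meritReal_contraction hs hPL hp hmin hvar hα₃ (π k) _) T
    have hfin := NormPRR.final_bound (m := 1) (T := T) hμ hτ hlam hα one_pos (hmerit0 z₁) hνdef hνα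
      (hmerit _) (by rw [div_one]; exact hrec)
    rwa [one_mul] at hfin
  refine ⟨hdet, ?_, ?_⟩
  · intro Ω _ P _ π hπ T _
    rcases hσ with htop | ⟨s, hs0, hseq, hvar⟩
    · exact hinf T _ (by positivity) _ htop
    let _ : MeasurableSpace (Equiv.Perm (Fin n)) := ⊤
    have hfac : (0 : ℝ) < n.factorial := by exact_mod_cast n.factorial_pos
    have hexp := NormPRR.lintegral_ofReal_iterate_le (P := P) (π := π) (z := z₁)
      (c := (n.factorial : ℝ)⁻¹) hπ.1 hπ.2.1 (by positivity)
      (fun k σ => by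
        rw [hπ.2.2 k σ, ENNReal.ofReal_inv_of_pos hfac, ENNReal.ofReal_natCast])
      (step := fun σ z => NormPRR.innerIter lam f φ (α / n) σ z n)
      (Z := fun π k => NormPRR.zIter lam f φ (fun _ => α / n) π z₁ k)
      (fun _ => rfl) (fun _ _ => rfl)
      (Y := fun z => NormPRR.meritReal τ lam f φ z - p) hmerit0
      (q := 1 - ν * α) (B := 2 * C * α ^ 3 * s / n) (by linarith) (by linarith) (by positivity)
      (fun z => h.meritReal_contraction_average hs hPL hp hmin hvar hα₃ z) T
    set R := (1 - ν * α) ^ T * (NormPRR.meritReal τ lam f φ z₁ - p)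
      + 2 * C * α ^ 3 * s / n / (1 - (1 - ν * α)) with hR
    -- `R` bounds the expected merit gap, so the deterministic estimate applies with `x = R`; here
    -- `m = n`, whereas part (a) has `m = 1`.
    have hfin := NormPRR.final_bound (m := n) (T := T) (Δ := R / (1 + μ * τ * lam)) hμ hτ hlam hα
      hn' (hmerit0 z₁) hνdef hνα (le_of_eq (by field_simp)) hR.le
    have hle : ∫⁻ ω, (NormPRR.objective f φ
            (NormPRR.wIter lam f φ (fun _ => α / n) (fun k => π k ω) z₁ T)
          - NormPRR.optVal (NormPRR.objective f φ)).toENNReal ∂P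
        ≤ ENNReal.ofReal (R / (1 + μ * τ * lam)) := by
      calc _ ≤ ∫⁻ ω, ENNReal.ofReal (1 + μ * τ * lam)⁻¹ * ENNReal.ofReal
            (NormPRR.meritReal τ lam f φ
              (NormPRR.zIter lam f φ (fun _ => α / n) (fun k => π k ω) z₁ T) - p) ∂P := by
            refine lintegral_mono fun ω => ?_
            rw [NormPRR.wIter, hgap, EReal.toENNReal_of_ne_top (EReal.coe_ne_top _),
              EReal.toReal_coe, ← ENNReal.ofReal_mul (by positivity)]
            refine ENNReal.ofReal_le_ofReal ?_
            rw [← div_eq_inv_mul, le_div_iff₀' hA]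
            exact hmerit _
        _ ≤ ENNReal.ofReal (1 + μ * τ * lam)⁻¹ * ENNReal.ofReal R := by
            rw [lintegral_const_mul' _ _ ENNReal.ofReal_ne_top]
            gcongr
        _ = _ := by
            rw [← ENNReal.ofReal_mul (by positivity), ← div_eq_inv_mul]
    have hR0 : 0 ≤ R := by
      have h1 := hmerit0 z₁
      have h2 : 0 ≤ 1 - ν * α := by linarith
      have h3 : 0 < 1 - (1 - ν * α) := by linarith
      positivity
    refine (EReal.coe_ennreal_le_coe_ennreal_iff.2 hle).trans ?_
    rw [EReal.coe_ennreal_ofReal, max_eq_left (by positivity), hseq, hlin, ← EReal.coe_mul,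
      ← EReal.coe_add, EReal.coe_le_coe_iff]
    exact hfin
  · intro h0 π T hT
    have := hdet π T hT
    rwa [h0, mul_zero, add_zero] at this
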